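/- Setting. Let $(h_n)_{n\ge 1}$ be positive numbers with $nh_n\to\infty$ and $nh_n^{\kappa}\to 0$ for some $\kappa>0$. On a probability space, for each $n\ge 1$ and $l\in\{1,2\}$, let $0=S^{n,l}_0<S^{n,l}_1<\dots<S^{n,l}_{M_l}=nh_n$ be random times, where $M_l=M_l^n$ is a random positive integer. Put $I_i^l=(S^{n,l}_{i-1},S^{n,l}_i]$ for $1\le i\le M_l$, let $|I|$ denote the length of an interval $I$, let $\mathcal N^{n,l}_t=\#\{1\le i\le M_l: S^{n,l}_i\le t\}$, and let $$G=\Big\{\tfrac{|I_i^1\cap I_j^2|}{|I_i^1|^{1/2}|I_j^2|^{1/2}}\Big\}_{1\le i\le M_1,\ 1\le j\le M_2}.$$ Let $\mathfrak S$ be the set of partitions $0=s_0<s_1<\cdots$ of $[0,\infty)$ with $\sup_{k\ge1}|s_k-s_{k-1}|\le 1$ and $\inf_{k\ge1}|s_k-s_{k-1}|>0$. For $(s_k)\in\mathfrak S$ let $q_n=\max\{k: s_k\le nh_n\}$, let $M_{l,k}=\#\{1\le i\le M_l: S_i^{n,l}\in(s_{k-1},s_k]\}$, and let $\mathcal E_{(k)}^1$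 be the diagonal $M_1\times M_1$ matrix with $(i,i)$ entry $1$ if $S_i^{n,1}\in(s_{k-1},s_k]$ and $0$ otherwise. A maximum over an empty set of indices is $0$. For $q>0$ consider the conditions (B1-$q$) $\ \sup_{n\ge1}\max_{l}\sup_{0\le t\le (n-1)h_n}E[(\mathcal N^{n,l}_{t+h_n}-\mathcal N^{n,l}_t)^q]<\infty$; (B2-$q$) $\ \limsup_{u\to\infty}\sup_{n\ge1}\max_{l}\sup_{0\le t\le nh_n-uh_n}u^qP(\mathcal N^{n,l}_{t+uh_n}-\mathcal N^{n,l}_t=0)<\infty$. For $0\le i,j\le n$ let $\mathcal G^n_{i,j}=\sigma(\mathcal N^{n,l}_t-\mathcal N^{n,l}_s:\ ih_n\le s<t\le jh_n,\ l=1,2)$, and let $$\alpha^n_k=0\vee\sup_{1\le i,j\le n-1,\ j-i\ge k}\ \sup_{A\in\mathcal G^n_{0,i}}\ \sup_{B\in\mathcal G^n_{j,n}}|P(A\cap B)-P(A)P(B)|.$$ Proposition. Assume that for every $q>0$ conditions (B1-$q$) and (B2-$q$) hold and $\sup_{n\ge1}\sum_{k=0}^\infty(k+1)^q\alpha^n_k<\infty$.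 Assume moreover that there exist constants $a_0^1,a_0^2>0$ and $a_p^1\ge0$ ($p=1,2,\dots$) such that, as $n\to\infty$, $$\max_{1\le k\le q_n}|h_nE[M_{l,k}]-a_0^l(s_k-s_{k-1})|\to0,\qquad \max_{1\le k\le q_n}|h_nE[\mathrm{tr}(\mathcal E^1_{(k)}(GG^\top)^p)]-a_p^1(s_k-s_{k-1})|\to0$$ for all $l\in\{1,2\}$, $p\ge1$ and $(s_k)\in\mathfrak S$. Then the following assumption (A4) holds. There exist constants $a_0^1,a_0^2>0$ such that, for $l\in\{1,2\}$ and every $(s_k)\in\mathfrak S$, the sequence $\{h_nM_{l,q_n+1}\}_{n\ge1}$ is tight and $\max_{1\le k\le q_n}|h_nM_{l,k}-a_0^l(s_k-s_{k-1})|\to0$ in probability. Moreover, for every integer $p\ge1$ there exists a constant $a_p^1\ge0$ such that $\max_{1\le k\le q_n}|h_n\mathrm{tr}(\mathcal E^1_{(k)}(GG^\top)^p)-a_p^1(s_k-s_{k-1})|\to0$ in probability for every $(s_k)\in\mathfrak S$. -/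

import Mathlib

open MeasureTheory Filter Topology
open scoped ENNReal NNReal

/-- Nonsynchronous observation times of a two-dimensional process on `[0, n h_n]`, `n ≥ 1`.
The component `l : Fin 2` is observed at the random times
`0 = time n l 0 < time n l 1 < ⋯ < time n l (numObs n l) = n h_n`;
the values of `time n l i` for `i > numObs n l` play no role. -/
structure ObservationScheme (Ω : Type*) [MeasurableSpace Ω] (h : ℕ → ℝ) where
  /-- the random number `M_l` of observation intervals of component `l` -/
  numObs : ℕ → Fin 2 → Ω → ℕ
  /-- the random times `S_i^{n,l}` -/
  time : ℕ → Fin 2 → ℕ → Ω → ℝ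
  measurable_numObs : ∀ n l, Measurable (numObs n l)
  measurable_time : ∀ n l i, Measurable (time n l i)
  numObs_pos : ∀ n, 1 ≤ n → ∀ l ω, 0 < numObs n l ω
  time_zero : ∀ n, 1 ≤ n → ∀ l ω, time n l 0 ω = 0
  time_last : ∀ n, 1 ≤ n → ∀ l ω, time n l (numObs n l ω) ω = n * h n
  time_lt_succ : ∀ n, 1 ≤ n → ∀ l ω i, i < numObs n l ω → time n l i ω < time n l (i + 1) ω

/-- The class of partitions `0 = s_0 < s_1 < ⋯` of `[0, ∞)` with `sup_k |s_k - s_{k-1}| ≤ 1` and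
`inf_k |s_k - s_{k-1}| > 0`. The lower bound on the mesh forces `s_k → ∞`. -/
structure IsAdmissiblePartition (s : ℕ → ℝ) : Prop where
  zero : s 0 = 0
  mesh_le : ∀ k, s (k + 1) - s k ≤ 1
  le_mesh : ∃ δ : ℝ, 0 < δ ∧ ∀ k, δ ≤ s (k + 1) - s k

/-- `q_n = max {k ; s_k ≤ T}`, used with `T = n h_n`. -/
noncomputable def lastIndex (s : ℕ → ℝ) (T : ℝ) : ℕ := sSup {k | s k ≤ T}

/-- `max_{1 ≤ k ≤ q} |x_k|`, equal to `0` when `q = 0`. -/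
noncomputable def maxAbs (q : ℕ) (x : ℕ → ℝ) : ℝ :=
  ((Finset.Icc 1 q).sup fun k => ‖x k‖₊ : ℝ≥0)

namespace ObservationScheme

variable {Ω : Type*} [MeasurableSpace Ω] {h : ℕ → ℝ}

/-- The counting process `N_t^{n,l} = ∑_{i=1}^{M_l} 1{S_i^{n,l} ≤ t}`. -/
noncomputable def counting (X : ObservationScheme Ω h) (n : ℕ) (l : Fin 2) (t : ℝ) (ω : Ω) : ℕ :=
  ((Finset.Icc 1 (X.numObs n l ω)).filter fun i => X.time n l i ω ≤ t).card

/-- `M_{l,k} = #{i ; sup I_i^l ∈ (s_{k-1}, s_k]}` for `k ≥ 1`, with `I_i^l = (S_{i-1}, S_i]`. -/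
noncomputable def cellCount (X : ObservationScheme Ω h) (n : ℕ) (l : Fin 2) (s : ℕ → ℝ) (k : ℕ)
    (ω : Ω) : ℕ :=
  ((Finset.Icc 1 (X.numObs n l ω)).filter fun i =>
    s (k - 1) < X.time n l i ω ∧ X.time n l i ω ≤ s k).card

/-- The matrix `G` with entries `|I_i^1 ∩ I_j^2| / (|I_i^1|^{1/2} |I_j^2|^{1/2})`. The row
`i : Fin M_1` stands for the interval `(S_i, S_{i+1}]`; likewise for columns. -/
noncomputable def overlapMatrix (X : ObservationScheme Ω h) (n : ℕ) (ω : Ω) :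
    Matrix (Fin (X.numObs n 0 ω)) (Fin (X.numObs n 1 ω)) ℝ :=
  Matrix.of fun i j =>
    max 0 (min (X.time n 0 (i + 1) ω) (X.time n 1 (j + 1) ω)
        - max (X.time n 0 i ω) (X.time n 1 j ω)) /
      (Real.sqrt (X.time n 0 (i + 1) ω - X.time n 0 i ω) *
        Real.sqrt (X.time n 1 (j + 1) ω - X.time n 1 j ω))

/-- The diagonal `0`-`1` matrix of size `M_1` selecting the intervals of the first component whose
right endpoint lies in `(s_{k-1}, s_k]`. -/
noncomputable def cellMatrix (X : ObservationScheme Ω h) (n : ℕ) (s : ℕ → ℝ) (k : ℕ) (ω : Ω) :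
    Matrix (Fin (X.numObs n 0 ω)) (Fin (X.numObs n 0 ω)) ℝ :=
  Matrix.diagonal fun i =>
    if s (k - 1) < X.time n 0 (i + 1) ω ∧ X.time n 0 (i + 1) ω ≤ s k then 1 else 0

/-- `tr (E_(k)^1 (G Gᵀ)^p)`. -/
noncomputable def cellTrace (X : ObservationScheme Ω h) (n p : ℕ) (s : ℕ → ℝ) (k : ℕ)
    (ω : Ω) : ℝ :=
  (X.cellMatrix n s k ω * (X.overlapMatrix n ω * (X.overlapMatrix n ω).transpose) ^ p).trace

/-- Condition (B1-q): the `q`-th moments of `N_{t+h_n} - N_t` are bounded, uniformly in `n ≥ 1`,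
`l` and `0 ≤ t ≤ (n - 1) h_n`. -/
def CondB1 (X : ObservationScheme Ω h) (P : Measure Ω) (q : ℝ) : Prop :=
  ∃ C : ℝ≥0, ∀ n : ℕ, 1 ≤ n → ∀ (l : Fin 2) (t : ℝ), 0 ≤ t → t ≤ ((n : ℝ) - 1) * h n →
    ∫⁻ ω, ((X.counting n l (t + h n) ω - X.counting n l t ω : ℕ) : ℝ≥0∞) ^ q ∂P ≤ C

/-- Condition (B2-q): `limsup_{u → ∞} sup_{n,l,t} u^q P(N_{t+u h_n} - N_t = 0) < ∞`, with `t`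
ranging over `0 ≤ t ≤ n h_n - u h_n`. -/
def CondB2 (X : ObservationScheme Ω h) (P : Measure Ω) (q : ℝ) : Prop :=
  ∃ C : ℝ, ∀ᶠ u : ℝ in atTop, ∀ n : ℕ, 1 ≤ n → ∀ (l : Fin 2) (t : ℝ),
    0 ≤ t → t ≤ n * h n - u * h n →
      u ^ q * P.real {ω | X.counting n l (t + u * h n) ω - X.counting n l t ω = 0} ≤ C

/-- The σ-algebra `σ(N_t^{n,l} - N_s^{n,l} ; i h_n ≤ s < t ≤ j h_n, l = 1, 2)`. -/
@[reducible]
noncomputable def incrementSigma (X : ObservationScheme Ω h) (n i j : ℕ) : MeasurableSpace Ω :=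
  ⨆ (l : Fin 2) (s : ℝ) (t : ℝ) (_ : i * h n ≤ s ∧ s < t ∧ t ≤ j * h n),
    MeasurableSpace.comap (fun ω => X.counting n l t ω - X.counting n l s ω) ⊤

/-- The mixing coefficient `α_k^n`: the supremum of `|P(A ∩ B) - P(A) P(B)|` over
`1 ≤ i, j ≤ n - 1` with `j - i ≥ k`, `A ∈ G_{0,i}^n`, `B ∈ G_{j,n}^n`
(and `0` when there are no such `i, j`). -/
noncomputable def mixingCoeff (X : ObservationScheme Ω h) (P : Measure Ω) (n k : ℕ) : ℝ≥0∞ :=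
  ⨆ (i : ℕ) (j : ℕ) (_ : 1 ≤ i ∧ i + 1 ≤ n ∧ 1 ≤ j ∧ j + 1 ≤ n ∧ i + k ≤ j)
    (A : Set Ω) (B : Set Ω)
    (_ : MeasurableSet[X.incrementSigma n 0 i] A ∧ MeasurableSet[X.incrementSigma n j n] B),
    ENNReal.ofReal |P.real (A ∩ B) - P.real A * P.real B|

/-- `sup_n ∑_{k ≥ 0} (k+1)^q α_k^n < ∞`. -/
def CondMixing (X : ObservationScheme Ω h) (P : Measure Ω) (q : ℝ) : Prop :=
  ∃ C : ℝ≥0, ∀ n : ℕ, 1 ≤ n → ∑' k : ℕ, ((k : ℝ≥0∞) + 1) ^ q * X.mixingCoeff P n k ≤ C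

/-- Convergence of the averages: there are constants `a₀ 0, a₀ 1 > 0` and `a p ≥ 0` (`p ≥ 1`) such
that, for every admissible partition, `max_{1 ≤ k ≤ q_n} |h_n E[M_{l,k}] - a₀ l (s_k - s_{k-1})|`
and `max_{1 ≤ k ≤ q_n} |h_n E[tr (E_(k)^1 (G Gᵀ)^p)] - a p (s_k - s_{k-1})|` tend to `0`.
For `p = 0` the trace is `M_{1,k}`, which the first convergence covers. -/
def CondAverage (X : ObservationScheme Ω h) (P : Measure Ω) : Prop :=
  ∃ (a₀ : Fin 2 → ℝ) (a : ℕ → ℝ), (∀ l, 0 < a₀ l) ∧ (∀ p, 1 ≤ p → 0 ≤ a p) ∧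
    ∀ s : ℕ → ℝ, IsAdmissiblePartition s →
      (∀ l : Fin 2, Tendsto (fun n : ℕ => maxAbs (lastIndex s (n * h n)) fun k =>
          h n * (∫ ω, (X.cellCount n l s k ω : ℝ) ∂P) - a₀ l * (s k - s (k - 1)))
        atTop (𝓝 0)) ∧
      (∀ p : ℕ, 1 ≤ p → Tendsto (fun n : ℕ => maxAbs (lastIndex s (n * h n)) fun k =>
          h n * (∫ ω, X.cellTrace n p s k ω ∂P) - a p * (s k - s (k - 1)))
        atTop (𝓝 0))

/-- Assumption (A4). -/
def AssumptionA4 (X : ObservationScheme Ω h) (P : Measure Ω) : Prop :=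
  (∃ a₀ : Fin 2 → ℝ, (∀ l, 0 < a₀ l) ∧
    ∀ (l : Fin 2) (s : ℕ → ℝ), IsAdmissiblePartition s →
      IsTightMeasureSet ((fun n : ℕ => P.map fun ω =>
        h n * (X.cellCount n l s (lastIndex s (n * h n) + 1) ω : ℝ)) '' Set.Ici 1) ∧
      TendstoInMeasure P (fun (n : ℕ) ω => maxAbs (lastIndex s (n * h n)) fun k =>
        h n * (X.cellCount n l s k ω : ℝ) - a₀ l * (s k - s (k - 1))) atTop (fun _ => 0)) ∧
  ∀ p : ℕ, 1 ≤ p → ∃ a : ℝ, 0 ≤ a ∧ ∀ s : ℕ → ℝ, IsAdmissiblePartition s →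
    TendstoInMeasure P (fun (n : ℕ) ω => maxAbs (lastIndex s (n * h n)) fun k =>
      h n * X.cellTrace n p s k ω - a * (s k - s (k - 1))) atTop (fun _ => 0)

end ObservationScheme

/-!
The cell quantities are sums of about `1 / h_n` contributions, one for each grid step
`(u h_n, (u + 1) h_n]`, and their rescaled means converge by assumption. It suffices to show that
they concentrate around their means, uniformly over the at most polynomially many (in `1 / h_n`)
cells. This is done for any nondecreasing quantity that is dominated by the counting process and
whose increments over grid steps are local (`ObservationScheme.IsLocalCumulative`).

The trace of `(G Gᵀ)^p` is of this kind. Its diagonal entries lie in `[0, 1]`: they are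
nonnegative, and the vector of the square roots of the interval lengths is a positive
superharmonic vector of `G Gᵀ` (`pathWeight_self_le_one`). They are sums over paths of length
`2 p` through overlapping intervals (`ObservationScheme.ofReal_overlapMatrix_gram_pow`). If each
stretch of `d` grid steps contains an observation, then no interval is longer than `2 d h_n`, so
that such a path stays in a window of `O(p d)` grid steps, and the entry is a function of the
observation times clamped to this window (`pathTrace_eq_of_agreesBetween`). The clamped times are
measurable for the σ-algebra of the increments over the window
(`ObservationScheme.measurable_localTime`), to which the mixing condition applies.

For the concentration, let `b` be of order `(1 / h_n)^(1/8)`. By the conditions on the gaps and on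
the moments, with a probability tending to `1` there are observations in each stretch of `b` grid
steps and no step has more than `b` of them
(`ObservationScheme.exists_measureReal_goodEvent_compl_le`). On this event the contributions of
the steps are local variables with values in `[0, b]`. Distributed over `O(b)` residue classes,
they are `b` steps apart within each class, and their mixing coefficients are smaller than any
power of `1 / b`. Expanding the `2 q`-th power of a centred sum over a class, each product in
which some factor occurs only once has a negligible expectation, and there are only `O(N^q)` other
products (`integral_sum_pow_le`). For `q` large, Markov's inequality and a union bound over the
cells conclude (`ObservationScheme.IsLocalCumulative.tendstoInMeasure_maxAbs`).
-/

/-! ### Mixing and moments -/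

section Mixing

variable {Ω : Type*} {m m₁ m₂ : MeasurableSpace Ω} [m₀ : MeasurableSpace Ω] {P : Measure Ω}
  [IsProbabilityMeasure P]

/-- The covariance of `U` with bounded `m`-measurable variables is controlled by its covariance with
indicators. After conditioning `U` on `m`, the worst bounded variable is a sign, which is
a difference of two indicators. -/
lemma abs_cov_le_of_abs_cov_set_le (hm : m ≤ m₀) {U V : Ω → ℝ} {c β : ℝ}
    (hU : Integrable U P) (hV : Measurable[m] V) (hVc : ∀ ω, |V ω| ≤ c)
    (hβ : ∀ B, MeasurableSet[m] B → |∫ ω in B, U ω ∂P - P.real B * ∫ ω, U ω ∂P| ≤ β) :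
    |∫ ω, U ω * V ω ∂P - (∫ ω, U ω ∂P) * ∫ ω, V ω ∂P| ≤ 2 * c * β := by
  set μU := ∫ ω, U ω ∂P with hμU
  set U₀ : Ω → ℝ := fun ω => U ω - μU with hU₀
  have hU₀i : Integrable U₀ P := hU.sub (integrable_const _)
  have hVm : AEStronglyMeasurable V P := (hV.mono hm le_rfl).aestronglyMeasurable
  have hVb : ∀ᵐ ω ∂P, ‖V ω‖ ≤ c := ae_of_all _ hVc
  have hVi : Integrable V P := Integrable.of_bound hVm c hVb
  have hUV : Integrable (fun ω => U ω * V ω) P := hU.mul_bdd hVm hVb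
  have hUV₀ : Integrable (V * U₀) P := by
    have := hU₀i.mul_bdd hVm hVb
    refine this.congr (ae_of_all _ fun ω => ?_)
    simp [mul_comm]
  have h1 : ∫ ω, U ω * V ω ∂P - μU * ∫ ω, V ω ∂P = ∫ ω, V ω * U₀ ω ∂P := by
    rw [← integral_const_mul, ← integral_sub hUV (hVi.const_mul _)]
    refine integral_congr_ae (ae_of_all _ fun ω => ?_)
    simp only [hU₀]; ring
  set g : Ω → ℝ := P[U₀|m] with hg
  have hgi : Integrable g P := integrable_condExp
  have hgm : StronglyMeasurable[m] g := stronglyMeasurable_condExp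
  have h2 : ∫ ω, V ω * U₀ ω ∂P = ∫ ω, V ω * g ω ∂P := by
    have h3 : ∫ ω, (P[V * U₀|m]) ω ∂P = ∫ ω, (V * U₀) ω ∂P := integral_condExp hm
    have h4 : P[V * U₀|m] =ᵐ[P] V * P[U₀|m] :=
      condExp_mul_of_stronglyMeasurable_left hV.stronglyMeasurable hUV₀ hU₀i
    rw [integral_congr_ae h4] at h3
    exact h3.symm
  have hset : ∀ B, MeasurableSet[m] B → |∫ ω in B, g ω ∂P| ≤ β := by
    intro B hB
    rw [setIntegral_condExp hm hU₀i hB]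
    have : ∫ ω in B, U₀ ω ∂P = ∫ ω in B, U ω ∂P - P.real B * μU := by
      simp only [hU₀]
      rw [integral_sub hU.integrableOn (integrable_const _)]
      simp
    rw [this]; exact hβ B hB
  set S : Set Ω := {ω | 0 ≤ g ω} with hS
  have hSm : MeasurableSet[m] S := hgm.measurable measurableSet_Ici
  have habs : ∫ ω, |g ω| ∂P ≤ 2 * β := by
    have h5 := integral_add_compl (hm S hSm) hgi.abs
    have h6 : ∫ ω in S, |g ω| ∂P = ∫ ω in S, g ω ∂P :=
      setIntegral_congr_fun (hm S hSm) fun ω hω => abs_of_nonneg hω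
    have h7 : ∫ ω in Sᶜ, |g ω| ∂P = - ∫ ω in Sᶜ, g ω ∂P := by
      rw [← integral_neg]
      refine setIntegral_congr_fun (hm S hSm).compl fun ω hω => abs_of_neg ?_
      simpa [hS] using hω
    have h8 := (abs_le.1 (hset S hSm)).2
    have h9 := (abs_le.1 (hset Sᶜ hSm.compl)).1
    linarith
  rw [h1, h2]
  calc |∫ ω, V ω * g ω ∂P| ≤ ∫ ω, |V ω * g ω| ∂P := abs_integral_le_integral_abs
    _ ≤ ∫ ω, c * |g ω| ∂P := by
        refine integral_mono_of_nonneg (ae_of_all _ fun ω => abs_nonneg _)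
          (hgi.abs.const_mul c) (ae_of_all _ fun ω => ?_)
        simp only [abs_mul]
        exact mul_le_mul_of_nonneg_right (hVc ω) (abs_nonneg _)
    _ = c * ∫ ω, |g ω| ∂P := integral_const_mul _ _
    _ ≤ c * (2 * β) := by
        refine mul_le_mul_of_nonneg_left habs ?_
        obtain ⟨ω⟩ : Nonempty Ω := P.nonempty_of_neZero
        exact (abs_nonneg _).trans (hVc ω)
    _ = 2 * c * β := by ring

/-- `α` bounds the strong mixing coefficient of `m₁` and `m₂`. -/
def MixingBound {Ω : Type*} [MeasurableSpace Ω] (P : Measure Ω) (m₁ m₂ : MeasurableSpace Ω)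
    (α : ℝ) : Prop :=
  ∀ A B, MeasurableSet[m₁] A → MeasurableSet[m₂] B → |P.real (A ∩ B) - P.real A * P.real B| ≤ α

/-- The covariance inequality for bounded variables, by passing from sets to variables in one
argument after the other. -/
lemma MixingBound.abs_cov_le (hm₁ : m₁ ≤ m₀) (hm₂ : m₂ ≤ m₀)
    {α a c : ℝ} (hα : MixingBound P m₁ m₂ α) {U V : Ω → ℝ} (hU : Measurable[m₁] U)
    (hV : Measurable[m₂] V) (hUa : ∀ ω, |U ω| ≤ a) (hVc : ∀ ω, |V ω| ≤ c) :
    |∫ ω, U ω * V ω ∂P - (∫ ω, U ω ∂P) * ∫ ω, V ω ∂P| ≤ 4 * a * c * α := by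
  have hUi : Integrable U P :=
    Integrable.of_bound (hU.mono hm₁ le_rfl).aestronglyMeasurable a (ae_of_all _ hUa)
  have := abs_cov_le_of_abs_cov_set_le (β := 2 * a * α) hm₂ hUi hV hVc ?_
  · linarith
  intro B hB
  have hB' := hm₂ B hB
  -- exchange the roles: the covariance of `1_B` and `U`, with `U` measurable for `m₁`
  have := abs_cov_le_of_abs_cov_set_le (β := α) (U := B.indicator fun _ => (1 : ℝ)) hm₁
    ((integrable_const (μ := P) (1 : ℝ)).indicator hB') hU hUa ?_
  · have e1 : ∫ ω, B.indicator (fun _ => (1 : ℝ)) ω * U ω ∂P = ∫ ω in B, U ω ∂P := by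
      rw [← integral_indicator hB']
      refine integral_congr_ae (ae_of_all _ fun ω => ?_)
      by_cases h : ω ∈ B <;> simp [h]
    have e2 : ∫ ω, B.indicator (fun _ => (1 : ℝ)) ω ∂P = P.real B := by
      rw [integral_indicator hB']; simp
    rw [e1, e2] at this
    exact this
  intro A hA
  have e2 : ∫ ω, B.indicator (fun _ => (1 : ℝ)) ω ∂P = P.real B := by
    rw [integral_indicator hB']; simp
  have e3 : ∫ ω in A, B.indicator (fun _ => (1 : ℝ)) ω ∂P = P.real (A ∩ B) := by
    rw [setIntegral_indicator hB']; simp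
  rw [e2, e3]
  exact hα A B hA hB

lemma mixingBound_bot_left {α : ℝ} (hα : 0 ≤ α) : MixingBound P ⊥ m α := by
  intro A B hA _
  rcases MeasurableSpace.measurableSet_bot_iff.1 hA with rfl | rfl <;> simpa

lemma mixingBound_bot_right {α : ℝ} (hα : 0 ≤ α) : MixingBound P m ⊥ α := by
  intro A B _ hB
  rcases MeasurableSpace.measurableSet_bot_iff.1 hB with rfl | rfl <;> simpa

/-- If no value of `f` is taken exactly once, then `f` takes at most `q` values, so it factors
through `Fin q`; this bounds the number of such `f`. -/
lemma card_filter_no_simple_value_le (q N : ℕ) :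
    ((Finset.univ : Finset (Fin (2 * q) → Fin N)).filter
      fun f => ∀ a, ∃ b, b ≠ a ∧ f b = f a).card ≤ N ^ q * q ^ (2 * q) := by
  classical
  have hsub : ((Finset.univ : Finset (Fin (2 * q) → Fin N)).filter
      fun f => ∀ a, ∃ b, b ≠ a ∧ f b = f a) ⊆
      (Finset.univ : Finset ((Fin q → Fin N) × (Fin (2 * q) → Fin q))).image
        fun p => p.1 ∘ p.2 := by
    intro f hf
    simp only [Finset.mem_filter, Finset.mem_univ, true_and] at hf
    simp only [Finset.mem_image, Finset.mem_univ, true_and, Prod.exists]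
    have hcard : (Finset.univ.image f).card ≤ q := by
      have h1 : 2 * (Finset.univ.image f).card ≤ (Finset.univ : Finset (Fin (2 * q))).card := by
        refine Finset.mul_card_image_le_card _ 2 fun y hy => ?_
        obtain ⟨a, -, rfl⟩ := Finset.mem_image.1 hy
        obtain ⟨b, hb, hfb⟩ := hf a
        exact Finset.one_lt_card.2 ⟨b, by simp [hfb], a, by simp, hb⟩
      simp at h1
      omega
    rcases Nat.eq_zero_or_pos q with rfl | hq
    · refine ⟨fun i => i.elim0, fun i => i.elim0, ?_⟩
      funext i; exact i.elim0
    have : Nonempty (Fin q) := ⟨⟨0, hq⟩⟩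
    obtain ⟨e⟩ : Nonempty ((Finset.univ.image f) ↪ Fin q) := by
      refine Function.Embedding.nonempty_of_card_le ?_
      rwa [Fintype.card_coe, Fintype.card_fin]
    have hne : Nonempty (Finset.univ.image f) := ⟨⟨f ⟨0, by omega⟩, by simp⟩⟩
    refine ⟨fun i => (Function.invFun e i).1, fun a => e ⟨f a, by simp⟩, ?_⟩
    funext a
    simp [Function.leftInverse_invFun e.injective _]
  refine (Finset.card_le_card hsub).trans (Finset.card_image_le.trans ?_)
  simp

lemma abs_prod_le_pow {ι : Type*} (s : Finset ι) (x : ι → ℝ) {B : ℝ} (hx : ∀ i, |x i| ≤ B) :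
    |∏ i ∈ s, x i| ≤ B ^ s.card := by
  rw [Finset.abs_prod]
  calc ∏ i ∈ s, |x i| ≤ ∏ _i ∈ s, B := Finset.prod_le_prod (fun i _ => abs_nonneg _) fun i _ => hx i
    _ = B ^ s.card := by simp

/-- Moment inequality for mixing sequences of bounded centred variables. In the expansion of the
power, a product in which some factor occurs only once has an expectation controlled by `α`, and
there are few other products. -/
lemma integral_sum_pow_le {N q : ℕ} {X : ℕ → Ω → ℝ} {𝓛 𝓡 : ℕ → MeasurableSpace Ω} {α B : ℝ}
    (hB : 0 ≤ B) (hα0 : 0 ≤ α) (h𝓛 : ∀ i, 𝓛 i ≤ m₀) (h𝓡 : ∀ i, 𝓡 i ≤ m₀)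
    (hX𝓛 : ∀ i j, j < i → Measurable[𝓛 i] (X j)) (hX𝓡 : ∀ i j, i ≤ j → Measurable[𝓡 i] (X j))
    (hXB : ∀ i ω, |X i ω| ≤ B) (hX0 : ∀ i, ∫ ω, X i ω ∂P = 0)
    (hα : ∀ i, MixingBound P (𝓛 i) (𝓡 i) α) :
    ∫ ω, (∑ i ∈ Finset.range N, X i ω) ^ (2 * q) ∂P ≤
      B ^ (2 * q) * ((N : ℝ) ^ q * (q : ℝ) ^ (2 * q) + (N : ℝ) ^ (2 * q) * (8 * α)) := by
  classical
  have hXm : ∀ i, Measurable (X i) := fun i => (hX𝓡 i i le_rfl).mono (h𝓡 i) le_rfl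
  have hprodm : ∀ (f : Fin (2 * q) → Fin N) (s : Finset (Fin (2 * q))),
      Measurable fun ω => ∏ a ∈ s, X (f a) ω := fun f s =>
    Finset.measurable_prod _ fun a _ => hXm _
  have hprodb : ∀ (f : Fin (2 * q) → Fin N) (s : Finset (Fin (2 * q))) (ω : Ω),
      |∏ a ∈ s, X (f a) ω| ≤ B ^ s.card := fun f s ω => abs_prod_le_pow _ _ fun a => hXB _ ω
  have hprodi : ∀ (f : Fin (2 * q) → Fin N) (s : Finset (Fin (2 * q))),
      Integrable (fun ω => ∏ a ∈ s, X (f a) ω) P := fun f s =>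
    Integrable.of_bound (hprodm f s).aestronglyMeasurable (B ^ s.card)
      (ae_of_all _ fun ω => by
      simpa only [Real.norm_eq_abs] using hprodb f s ω)
  have habsint : ∀ (f : Fin (2 * q) → Fin N) (s : Finset (Fin (2 * q))),
      |∫ ω, ∏ a ∈ s, X (f a) ω ∂P| ≤ B ^ s.card := by
    intro f s
    have := norm_integral_le_of_norm_le_const (μ := P) (f := fun ω => ∏ a ∈ s, X (f a) ω)
      (ae_of_all _ fun ω => by simpa only [Real.norm_eq_abs] using hprodb f s ω)
    simpa using this
  have hexp : ∫ ω, (∑ i ∈ Finset.range N, X i ω) ^ (2 * q) ∂P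
      = ∑ f : Fin (2 * q) → Fin N, ∫ ω, ∏ a, X (f a) ω ∂P := by
    rw [← integral_finsetSum _ fun f _ => hprodi f Finset.univ]
    refine integral_congr_ae (ae_of_all _ fun ω => ?_)
    simp only
    rw [Finset.sum_range, Fintype.sum_pow]
  have hsimple : ∀ f : Fin (2 * q) → Fin N, (¬ ∀ a, ∃ b, b ≠ a ∧ f b = f a) →
      |∫ ω, ∏ a, X (f a) ω ∂P| ≤ B ^ (2 * q) * (8 * α) := by
    intro f hf
    push Not at hf
    obtain ⟨a, ha⟩ := hf
    -- the factors before and after the index that occurs only once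
    set L := Finset.univ.filter fun b => f b < f a with hL
    set R := Finset.univ.filter fun b => f a < f b with hR
    have hLR : Finset.univ = insert a L ∪ R := by
      ext b
      simp only [hL, hR, Finset.mem_univ, Finset.mem_union, Finset.mem_insert, Finset.mem_filter,
        true_and, true_iff]
      by_cases hb : b = a
      · exact Or.inl (Or.inl hb)
      · rcases lt_or_gt_of_ne (ha b hb) with h | h
        · exact Or.inl (Or.inr h)
        · exact Or.inr h
    have haL : a ∉ L := by simp [hL]
    have hdis : Disjoint (insert a L) R := by
      rw [Finset.disjoint_left]
      intro b hb hb'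
      simp only [hL, hR, Finset.mem_insert, Finset.mem_filter, Finset.mem_univ, true_and]
        at hb hb'
      rcases hb with rfl | hb
      · exact lt_irrefl _ hb'
      · exact lt_asymm hb hb'
    have hcard : (insert a L).card + R.card = 2 * q := by
      rw [← Finset.card_union_of_disjoint hdis, ← hLR]; simp
    have hcard' : L.card + 1 + R.card = 2 * q := by
      have := hcard; rwa [Finset.card_insert_of_notMem haL] at this
    have hprod : ∀ ω, ∏ b, X (f b) ω
        = (∏ b ∈ insert a L, X (f b) ω) * ∏ b ∈ R, X (f b) ω := by
      intro ω; rw [hLR, Finset.prod_union hdis]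
    have hprod' : ∀ ω, ∏ b ∈ insert a L, X (f b) ω
        = (∏ b ∈ L, X (f b) ω) * X (f a) ω := by
      intro ω; rw [Finset.prod_insert haL, mul_comm]
    have hmL : Measurable[𝓛 (f a)] fun ω => ∏ b ∈ L, X (f b) ω :=
      Finset.measurable_prod _ fun b hb => hX𝓛 _ _ (by simpa [hL] using hb)
    have hmaL : Measurable[𝓛 (f a + 1)] fun ω => ∏ b ∈ insert a L, X (f b) ω := by
      refine Finset.measurable_prod _ fun b hb => hX𝓛 _ _ ?_
      rcases Finset.mem_insert.1 hb with rfl | hb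
      · exact Nat.lt_succ_self _
      · have : f b < f a := by simpa [hL] using hb
        exact Nat.lt_succ_of_lt this
    have hmR : Measurable[𝓡 (f a + 1)] fun ω => ∏ b ∈ R, X (f b) ω := by
      refine Finset.measurable_prod _ fun b hb => hX𝓡 _ _ ?_
      have : f a < f b := by simpa [hR] using hb
      exact this
    -- detach the later factors, then the centred factor from the earlier ones
    have c1 := (hα (f a + 1)).abs_cov_le (h𝓛 _) (h𝓡 _) hmaL hmR (hprodb f _) (hprodb f _)
    have c2 := (hα (f a)).abs_cov_le (h𝓛 _) (h𝓡 _) hmL (hX𝓡 (f a) (f a) le_rfl) (hprodb f _)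
      (hXB _)
    rw [hX0, mul_zero, sub_zero] at c2
    simp_rw [← hprod'] at c2
    have c3 := habsint f R
    have p1 : 4 * B ^ (insert a L).card * B ^ R.card * α = 4 * B ^ (2 * q) * α := by
      have := congrArg (B ^ ·) hcard
      simp only [pow_add] at this ⊢
      rw [← this]; ring
    have p2 : 4 * B ^ L.card * B * α * B ^ R.card = 4 * B ^ (2 * q) * α := by
      have := congrArg (B ^ ·) hcard'
      simp only [pow_add, pow_one] at this ⊢
      rw [← this]; ring
    simp_rw [hprod]
    calc _ ≤ |∫ ω, (∏ b ∈ insert a L, X (f b) ω) * ∏ b ∈ R, X (f b) ω ∂P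
            - (∫ ω, ∏ b ∈ insert a L, X (f b) ω ∂P) * ∫ ω, ∏ b ∈ R, X (f b) ω ∂P|
          + |(∫ ω, ∏ b ∈ insert a L, X (f b) ω ∂P) * ∫ ω, ∏ b ∈ R, X (f b) ω ∂P| := by
          have := abs_add_le (∫ ω, (∏ b ∈ insert a L, X (f b) ω) * ∏ b ∈ R, X (f b) ω ∂P
            - (∫ ω, ∏ b ∈ insert a L, X (f b) ω ∂P) * ∫ ω, ∏ b ∈ R, X (f b) ω ∂P)
            ((∫ ω, ∏ b ∈ insert a L, X (f b) ω ∂P) * ∫ ω, ∏ b ∈ R, X (f b) ω ∂P)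
          simpa using this
      _ ≤ 4 * B ^ (2 * q) * α + 4 * B ^ (2 * q) * α := by
          refine add_le_add (c1.trans_eq p1) ?_
          rw [abs_mul, ← p2]
          exact mul_le_mul c2 c3 (abs_nonneg _) (by positivity)
      _ = _ := by ring
  rw [hexp, ← Finset.sum_filter_add_sum_filter_not _
    fun f : Fin (2 * q) → Fin N => ∀ a, ∃ b, b ≠ a ∧ f b = f a]
  have s1 : ∑ f ∈ Finset.univ.filter (fun f : Fin (2 * q) → Fin N => ∀ a, ∃ b, b ≠ a ∧ f b = f a),
      ∫ ω, ∏ a, X (f a) ω ∂P ≤ ((N ^ q * q ^ (2 * q) : ℕ) : ℝ) * B ^ (2 * q) := by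
    refine (Finset.sum_le_card_nsmul _ _ (B ^ (2 * q)) fun f _ => ?_).trans ?_
    · have := (le_abs_self _).trans (habsint f Finset.univ)
      simpa using this
    · rw [nsmul_eq_mul]
      refine mul_le_mul_of_nonneg_right ?_ (by positivity)
      exact_mod_cast card_filter_no_simple_value_le q N
  have s2 : ∑ f ∈ Finset.univ.filter
      (fun f : Fin (2 * q) → Fin N => ¬ ∀ a, ∃ b, b ≠ a ∧ f b = f a),
      ∫ ω, ∏ a, X (f a) ω ∂P ≤ (N : ℝ) ^ (2 * q) * (B ^ (2 * q) * (8 * α)) := by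
    refine (Finset.sum_le_card_nsmul _ _ (B ^ (2 * q) * (8 * α)) fun f hf => ?_).trans ?_
    · exact (le_abs_self _).trans (hsimple f (Finset.mem_filter.1 hf).2)
    · rw [nsmul_eq_mul]
      refine mul_le_mul_of_nonneg_right ?_ (by positivity)
      have := Finset.card_filter_le (Finset.univ : Finset (Fin (2 * q) → Fin N))
        (fun f => ¬ ∀ a, ∃ b, b ≠ a ∧ f b = f a)
      simp only [Finset.card_univ, Fintype.card_fun, Fintype.card_fin] at this
      exact_mod_cast this
  push_cast at s1
  linarith

end Mixing

/-! ### Overlap ratios and path weights -/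

section PathWeight

/-- The ratio `|I_i ∩ J_k| / (|I_i|^{1/2} |J_k|^{1/2})` for the intervals `I_i = (x_i, x_{i+1}]` and
`J_k = (y_k, y_{k+1}]` cut out by two real sequences. It is `0` if one of them is degenerate. -/
noncomputable def overlapRatio (x y : ℕ → ℝ) (i k : ℕ) : ℝ :=
  max 0 (min (x (i + 1)) (y (k + 1)) - max (x i) (y k)) /
    (Real.sqrt (x (i + 1) - x i) * Real.sqrt (y (k + 1) - y k))

/-- The entries of `(G Gᵀ)^p`, where `G` is the infinite matrix of the overlap ratios of two
sequences: the total weight of the paths of length `2 p` from `i` to `i'` through overlapping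
intervals. Values in `[0, ∞]` make all sums over `ℕ` meaningful. -/
noncomputable def pathWeight (x y : ℕ → ℝ) : ℕ → ℕ → ℕ → ℝ≥0∞
  | 0, i, i' => if i = i' then 1 else 0
  | p + 1, i, i' => ∑' m, ∑' k, pathWeight x y p i m *
      (ENNReal.ofReal (overlapRatio x y m k) * ENNReal.ofReal (overlapRatio x y i' k))

/-- `x` is nondecreasing with increments at most `D`. -/
def MeshLE (x : ℕ → ℝ) (D : ℝ) : Prop := ∀ i, x i ≤ x (i + 1) ∧ x (i + 1) ≤ x i + D

variable {x y : ℕ → ℝ} {D : ℝ}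

lemma MeshLE.nonneg (hx : MeshLE x D) : 0 ≤ D := by linarith [hx 0]

lemma overlapRatio_nonneg (x y : ℕ → ℝ) (i k : ℕ) : 0 ≤ overlapRatio x y i k := by
  unfold overlapRatio; positivity

lemma overlapRatio_comm (x y : ℕ → ℝ) (i k : ℕ) : overlapRatio x y i k = overlapRatio y x k i := by
  unfold overlapRatio
  rw [min_comm, max_comm (x i), mul_comm]

lemma overlapRatio_eq_zero_of_le {i k : ℕ} (h : x (i + 1) ≤ x i) : overlapRatio x y i k = 0 := by
  unfold overlapRatio
  rw [Real.sqrt_eq_zero_of_nonpos (by linarith)]; simp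

lemma lt_of_overlapRatio_ne_zero {i k : ℕ} (h : overlapRatio x y i k ≠ 0) :
    x i < y (k + 1) ∧ y k < x (i + 1) := by
  by_contra hc
  apply h
  unfold overlapRatio
  rw [max_eq_left, zero_div]
  rw [not_and_or, not_lt, not_lt] at hc
  have h1 := min_le_left (x (i + 1)) (y (k + 1))
  have h2 := min_le_right (x (i + 1)) (y (k + 1))
  have h3 := le_max_left (x i) (y k)
  have h4 := le_max_right (x i) (y k)
  rcases hc with hc | hc <;> linarith

lemma abs_sub_le_of_overlapRatio_ne_zero (hx : MeshLE x D) (hy : MeshLE y D) {i k : ℕ}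
    (h : overlapRatio x y i k ≠ 0) : |y k - x i| ≤ D := by
  have := lt_of_overlapRatio_ne_zero h
  rw [abs_le]
  constructor <;> linarith [hx i, hy k]

lemma ofReal_overlapRatio_ne_zero {i k : ℕ} (h : ENNReal.ofReal (overlapRatio x y i k) ≠ 0) :
    overlapRatio x y i k ≠ 0 := fun h0 => h (by simp [h0])

/-- A path of length `2 p` moves by at most `2 p` mesh sizes. -/
lemma abs_sub_le_of_pathWeight_ne_zero (hx : MeshLE x D) (hy : MeshLE y D) {p i i' : ℕ}
    (h : pathWeight x y p i i' ≠ 0) : |x i' - x i| ≤ 2 * p * D := by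
  induction p generalizing i' with
  | zero =>
    have : i = i' := by
      by_contra hc; exact h (by simp [pathWeight, hc])
    simp [this]
  | succ p ih =>
    simp only [pathWeight, ne_eq, ENNReal.tsum_eq_zero, mul_eq_zero, not_forall, not_or] at h
    obtain ⟨m, k, h1, h2, h3⟩ := h
    have a1 := abs_le.1 (ih h1)
    have a2 := abs_le.1 (abs_sub_le_of_overlapRatio_ne_zero hx hy (ofReal_overlapRatio_ne_zero h2))
    have a3 := abs_le.1 (abs_sub_le_of_overlapRatio_ne_zero hx hy (ofReal_overlapRatio_ne_zero h3))
    push_cast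
    rw [abs_le]
    constructor <;> linarith

/-- The overlaps of `J_k` with the intervals of a partition add up to at most `|J_k|`, because
the overlap with `I_i` is an increment of the sequence `x` clamped to `J_k`. -/
lemma sum_overlapRatio_mul_sqrt_le (hx : ∀ i, x i ≤ x (i + 1)) (hy : ∀ k, y k ≤ y (k + 1))
    (k : ℕ) :
    ∑' i, ENNReal.ofReal (overlapRatio x y i k) * ENNReal.ofReal (Real.sqrt (x (i + 1) - x i)) ≤
      ENNReal.ofReal (Real.sqrt (y (k + 1) - y k)) := by
  refine ENNReal.tsum_le_of_sum_range_le fun N => ?_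
  simp_rw [← ENNReal.ofReal_mul (overlapRatio_nonneg _ _ _ _)]
  rw [← ENNReal.ofReal_sum_of_nonneg fun i _ =>
    mul_nonneg (overlapRatio_nonneg _ _ _ _) (Real.sqrt_nonneg _)]
  refine ENNReal.ofReal_le_ofReal ?_
  set c : ℕ → ℝ := fun i => max (y k) (min (y (k + 1)) (x i)) with hc
  have hterm : ∀ i, overlapRatio x y i k * Real.sqrt (x (i + 1) - x i) ≤
      (c (i + 1) - c i) / Real.sqrt (y (k + 1) - y k) := by
    intro i
    have hnum : max 0 (min (x (i + 1)) (y (k + 1)) - max (x i) (y k)) ≤ c (i + 1) - c i := by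
      have := hx i
      have := hy k
      simp only [hc]
      rcases le_total (x (i + 1)) (y (k + 1)) with h1 | h1 <;>
      rcases le_total (x i) (y k) with h2 | h2 <;>
      rcases le_total (x (i + 1)) (y k) with h3 | h3 <;>
      rcases le_total (x i) (y (k + 1)) with h4 | h4 <;>
      simp only [h1, h2, h3, h4, hy k, min_eq_left, min_eq_right, max_eq_left, max_eq_right] <;>
      (refine max_le ?_ ?_ <;> linarith)
    rcases (Real.sqrt_nonneg (x (i + 1) - x i)).eq_or_lt with h0 | h0
    · rw [← h0, mul_zero]
      exact div_nonneg ((le_max_left _ _).trans hnum) (Real.sqrt_nonneg _)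
    · have : overlapRatio x y i k * Real.sqrt (x (i + 1) - x i) =
          max 0 (min (x (i + 1)) (y (k + 1)) - max (x i) (y k)) / Real.sqrt (y (k + 1) - y k) := by
        unfold overlapRatio
        rw [div_mul_eq_mul_div, mul_comm (Real.sqrt _), mul_div_mul_right _ _ h0.ne']
      rw [this]
      exact div_le_div_of_nonneg_right hnum (Real.sqrt_nonneg _)
  calc ∑ i ∈ Finset.range N, overlapRatio x y i k * Real.sqrt (x (i + 1) - x i)
      ≤ ∑ i ∈ Finset.range N, (c (i + 1) - c i) / Real.sqrt (y (k + 1) - y k) :=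
        Finset.sum_le_sum fun i _ => hterm i
    _ = (c N - c 0) / Real.sqrt (y (k + 1) - y k) := by
        rw [← Finset.sum_div, Finset.sum_range_sub]
    _ ≤ (y (k + 1) - y k) / Real.sqrt (y (k + 1) - y k) := by
        refine div_le_div_of_nonneg_right ?_ (Real.sqrt_nonneg _)
        have h1 : c N ≤ y (k + 1) := max_le (hy k) (min_le_left _ _)
        have h2 : y k ≤ c 0 := le_max_left _ _
        linarith
    _ = Real.sqrt (y (k + 1) - y k) := Real.div_sqrt

/-- The vector of the square roots of the interval lengths is superharmonic for `(G Gᵀ)^p`. -/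
lemma tsum_pathWeight_mul_sqrt_le (hx : ∀ i, x i ≤ x (i + 1)) (hy : ∀ k, y k ≤ y (k + 1))
    (p i : ℕ) :
    ∑' i', pathWeight x y p i i' * ENNReal.ofReal (Real.sqrt (x (i' + 1) - x i')) ≤
      ENNReal.ofReal (Real.sqrt (x (i + 1) - x i)) := by
  induction p with
  | zero =>
    rw [tsum_eq_single i]
    · simp [pathWeight]
    · intro j hj; simp [pathWeight, hj.symm]
  | succ p ih =>
    simp only [pathWeight]
    calc _ = ∑' i', ∑' m, ∑' k, pathWeight x y p i m * (ENNReal.ofReal (overlapRatio x y m k) *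
            (ENNReal.ofReal (overlapRatio x y i' k) *
              ENNReal.ofReal (Real.sqrt (x (i' + 1) - x i')))) := by
          simp_rw [← ENNReal.tsum_mul_right, mul_assoc]
      _ = ∑' m, pathWeight x y p i m * ∑' k, ENNReal.ofReal (overlapRatio x y m k) *
            ∑' i', ENNReal.ofReal (overlapRatio x y i' k) *
              ENNReal.ofReal (Real.sqrt (x (i' + 1) - x i')) := by
          rw [ENNReal.tsum_comm]
          refine tsum_congr fun m => ?_
          rw [ENNReal.tsum_comm, ← ENNReal.tsum_mul_left]
          refine tsum_congr fun k => ?_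
          rw [← ENNReal.tsum_mul_left, ← ENNReal.tsum_mul_left]
      _ ≤ ∑' m, pathWeight x y p i m * ENNReal.ofReal (Real.sqrt (x (m + 1) - x m)) := by
          refine ENNReal.tsum_le_tsum fun m => mul_le_mul_right ?_ _
          refine le_trans (ENNReal.tsum_le_tsum fun k =>
            mul_le_mul_right (sum_overlapRatio_mul_sqrt_le hx hy k) _) ?_
          simp_rw [overlapRatio_comm x y]
          exact sum_overlapRatio_mul_sqrt_le hy hx m
      _ ≤ _ := ih

/-- The diagonal entries of `(G Gᵀ)^p` are at most `1`. -/
lemma pathWeight_self_le_one (hx : ∀ i, x i ≤ x (i + 1)) (hy : ∀ k, y k ≤ y (k + 1)) (p i : ℕ) :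
    pathWeight x y p i i ≤ 1 := by
  rcases (hx i).eq_or_lt with h0 | h0
  · -- a degenerate interval overlaps nothing
    cases p with
    | zero => simp [pathWeight]
    | succ p => simp [pathWeight, overlapRatio_eq_zero_of_le h0.ge]
  · have h1 := (ENNReal.le_tsum i).trans (tsum_pathWeight_mul_sqrt_le hx hy p i)
    have h2 : 0 < ENNReal.ofReal (Real.sqrt (x (i + 1) - x i)) :=
      ENNReal.ofReal_pos.2 (Real.sqrt_pos.2 (by linarith))
    rw [← ENNReal.mul_le_mul_iff_left h2.ne' ENNReal.ofReal_ne_top, one_mul]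
    exact h1

/-- Between the levels `σ` and `η` the sequence `x'` agrees with `x` shifted by `α`. -/
structure AgreesBetween (x x' : ℕ → ℝ) (α : ℕ) (σ η : ℝ) : Prop where
  eq_of_mem : ∀ j, σ ≤ x (α + j) → x (α + j) ≤ η → x' j = x (α + j)
  eq_of_mem' : ∀ j, σ ≤ x' j → x' j ≤ η → x' j = x (α + j)
  lt_of_lt : ∀ i, i < α → x i < σ

variable {x' y' : ℕ → ℝ} {α β : ℕ} {σ η : ℝ}

lemma AgreesBetween.mem_range (h : AgreesBetween x x' α σ η) {i : ℕ} (hi : σ ≤ x i) :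
    i ∈ Set.range (α + ·) := by
  refine ⟨i - α, ?_⟩
  have : ¬ i < α := fun hlt => absurd (h.lt_of_lt i hlt) (not_lt.2 hi)
  simp only; omega

/-- If `I_j` lies between the levels, an interval `J_k` that meets it in one of the two
configurations also lies between the levels, and hence is the same in both. -/
lemma overlapRatio_eq_of_agreesBetween (hx : AgreesBetween x x' α σ η)
    (hy : AgreesBetween y y' β σ η) (mx : MeshLE x D) (my : MeshLE y D) (my' : MeshLE y' D)
    {j : ℕ} (h1 : σ + D ≤ x (α + j)) (h2 : x (α + j) ≤ η - 2 * D) (k : ℕ) :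
    overlapRatio x' y' j k = overlapRatio x y (α + j) (β + k) := by
  have hD := mx.nonneg
  have m1 := mx (α + j)
  have e1 : x' j = x (α + j) := hx.eq_of_mem j (by linarith) (by linarith)
  have e2 : x' (j + 1) = x (α + j + 1) :=
    hx.eq_of_mem (j + 1) (by rw [← add_assoc]; linarith) (by rw [← add_assoc]; linarith)
  have key : y' k = y (β + k) → y' (k + 1) = y (β + k + 1) →
      overlapRatio x' y' j k = overlapRatio x y (α + j) (β + k) := by
    intro e3 e4
    simp only [overlapRatio, e1, e2, e3, e4]
  by_cases hg : overlapRatio x y (α + j) (β + k) = 0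
  · by_cases hg' : overlapRatio x' y' j k = 0
    · rw [hg, hg']
    · obtain ⟨a1, a2⟩ := lt_of_overlapRatio_ne_zero hg'
      have m2 := my' k
      exact key (hy.eq_of_mem' k (by linarith) (by linarith))
        (hy.eq_of_mem' (k + 1) (by linarith) (by linarith))
  · obtain ⟨a1, a2⟩ := lt_of_overlapRatio_ne_zero hg
    have m2 := my (β + k)
    exact key (hy.eq_of_mem k (by linarith) (by linarith))
      (hy.eq_of_mem (k + 1) (by rw [← add_assoc]; linarith) (by rw [← add_assoc]; linarith))

/-- Locality: sufficiently far inside the levels `σ`, `η`, the entries of `(G Gᵀ)^p` only depend on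
the two sequences between these levels. -/
lemma pathWeight_eq_of_agreesBetween (hx : AgreesBetween x x' α σ η)
    (hy : AgreesBetween y y' β σ η) (mx : MeshLE x D) (my : MeshLE y D) (mx' : MeshLE x' D)
    (my' : MeshLE y' D) (p : ℕ) {j : ℕ} (h1 : σ + (2 * p + 3) * D ≤ x (α + j))
    (h2 : x (α + j) ≤ η - (2 * p + 3) * D) (j' : ℕ) :
    pathWeight x' y' p j j' = pathWeight x y p (α + j) (α + j') := by
  have hD := mx.nonneg
  induction p generalizing j' with
  | zero => simp [pathWeight]
  | succ p ih =>
    have hpD : 0 ≤ p * D := by positivity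
    push_cast at h1 h2
    have ih' := ih (by linarith) (by linarith)
    simp only [pathWeight]
    have hinj : Function.Injective (α + · : ℕ → ℕ) := add_right_injective α
    have hinj' : Function.Injective (β + · : ℕ → ℕ) := add_right_injective β
    rw [← hinj.tsum_eq (f := fun m => ∑' k, pathWeight x y p (α + j) m *
      (ENNReal.ofReal (overlapRatio x y m k) * ENNReal.ofReal (overlapRatio x y (α + j') k)))]
    swap
    · intro m hm
      have hm0 : pathWeight x y p (α + j) m ≠ 0 := by
        intro h0; exact hm (by simp [h0])
      have := abs_le.1 (abs_sub_le_of_pathWeight_ne_zero mx my hm0)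
      exact hx.mem_range (by linarith)
    refine tsum_congr fun m => ?_
    rw [ih' m]
    by_cases hm0 : pathWeight x y p (α + j) (α + m) = 0
    · simp [hm0]
    have hm := abs_le.1 (abs_sub_le_of_pathWeight_ne_zero mx my hm0)
    rw [← hinj'.tsum_eq (f := fun k => pathWeight x y p (α + j) (α + m) *
      (ENNReal.ofReal (overlapRatio x y (α + m) k) * ENNReal.ofReal (overlapRatio x y (α + j') k)))]
    swap
    · intro k hk
      have hk0 : ENNReal.ofReal (overlapRatio x y (α + m) k) ≠ 0 := by
        intro h0; exact hk (by simp [h0])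
      have := abs_le.1 (abs_sub_le_of_overlapRatio_ne_zero mx my (ofReal_overlapRatio_ne_zero hk0))
      exact hy.mem_range (by linarith)
    refine tsum_congr fun k => ?_
    rw [overlapRatio_eq_of_agreesBetween hx hy mx my my' (by linarith) (by linarith) k]
    by_cases hk0 : overlapRatio x y (α + m) (β + k) = 0
    · simp [hk0]
    have hk := abs_le.1 (abs_sub_le_of_overlapRatio_ne_zero mx my hk0)
    rw [overlapRatio_comm x' y', overlapRatio_comm x y (α + j'),
      overlapRatio_eq_of_agreesBetween hy hx my mx mx' (by linarith) (by linarith) j']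

/-- The sum of the diagonal entries of `(G Gᵀ)^p` over the intervals `I_i` with right endpoint
in `(a, b]`. -/
noncomputable def pathTrace (x y : ℕ → ℝ) (p : ℕ) (a b : ℝ) : ℝ≥0∞ :=
  ∑' i, (Set.Ioc a b).indicator (fun _ => pathWeight x y p i i) (x (i + 1))

/-- The trace over the intervals with right endpoint in `(a, b]` depends only on the two sequences
in a neighbourhood of `[a, b]`. -/
lemma pathTrace_eq_of_agreesBetween (hx : AgreesBetween x x' α σ η)
    (hy : AgreesBetween y y' β σ η) (mx : MeshLE x D) (my : MeshLE y D) (mx' : MeshLE x' D)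
    (my' : MeshLE y' D) (p : ℕ) {a b : ℝ} (h1 : σ + (2 * p + 4) * D ≤ a)
    (h2 : b ≤ η - (2 * p + 3) * D) :
    pathTrace x' y' p a b = pathTrace x y p a b := by
  have hD := mx.nonneg
  have hpD : 0 ≤ p * D := by positivity
  unfold pathTrace
  have hinj : Function.Injective (α + · : ℕ → ℕ) := add_right_injective α
  rw [← hinj.tsum_eq (f := fun i => (Set.Ioc a b).indicator
    (fun _ => pathWeight x y p i i) (x (i + 1)))]
  swap
  · intro i hi
    have hmem : x (i + 1) ∈ Set.Ioc a b := by
      by_contra hc; exact hi (by simp only [Set.indicator_of_notMem hc])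
    exact hx.mem_range (by linarith [hmem.1, mx i])
  refine tsum_congr fun j => ?_
  by_cases hmem : x (α + j + 1) ∈ Set.Ioc a b
  · have m1 := mx (α + j)
    have e2 : x' (j + 1) = x (α + j + 1) :=
      hx.eq_of_mem (j + 1) (by rw [← add_assoc]; linarith [hmem.1])
        (by rw [← add_assoc]; linarith [hmem.2])
    rw [e2, Set.indicator_of_mem hmem, Set.indicator_of_mem hmem]
    exact pathWeight_eq_of_agreesBetween hx hy mx my mx' my' p (by linarith [hmem.1])
      (by linarith [hmem.2]) j
  · have hmem' : x' (j + 1) ∉ Set.Ioc a b := by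
      intro hc
      have e2 : x' (j + 1) = x (α + j + 1) :=
        hx.eq_of_mem' (j + 1) (by linarith [hc.1]) (by linarith [hc.2])
      rw [e2] at hc; exact hmem hc
    rw [Set.indicator_of_notMem hmem, Set.indicator_of_notMem hmem']

section Measurability

variable {Ω : Type*} {m : MeasurableSpace Ω} {X Y : ℕ → Ω → ℝ}

lemma measurable_overlapRatio (hX : ∀ i, Measurable (X i)) (hY : ∀ i, Measurable (Y i)) (i k : ℕ) :
    Measurable fun ω => overlapRatio (X · ω) (Y · ω) i k := by
  unfold overlapRatio
  have h1 := hX i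
  have h2 := hX (i + 1)
  have h3 := hY k
  have h4 := hY (k + 1)
  exact (measurable_const.max ((h2.min h4).sub (h1.max h3))).div
    ((h2.sub h1).sqrt.mul (h4.sub h3).sqrt)

lemma measurable_pathWeight (hX : ∀ i, Measurable (X i)) (hY : ∀ i, Measurable (Y i))
    (p i i' : ℕ) : Measurable fun ω => pathWeight (X · ω) (Y · ω) p i i' := by
  induction p generalizing i' with
  | zero => exact measurable_const
  | succ p ih =>
    simp only [pathWeight]
    exact Measurable.tsum fun m => Measurable.tsum fun k =>
      (ih m).mul ((measurable_overlapRatio hX hY m k).ennreal_ofReal.mul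
        (measurable_overlapRatio hX hY i' k).ennreal_ofReal)

lemma measurable_pathTrace (hX : ∀ i, Measurable (X i)) (hY : ∀ i, Measurable (Y i))
    (p : ℕ) (a b : ℝ) : Measurable fun ω => pathTrace (X · ω) (Y · ω) p a b := by
  refine Measurable.tsum fun i => ?_
  have : (fun ω => (Set.Ioc a b).indicator
      (fun _ => pathWeight (X · ω) (Y · ω) p i i) (X (i + 1) ω)) =
      (X (i + 1) ⁻¹' Set.Ioc a b).indicator fun ω => pathWeight (X · ω) (Y · ω) p i i := by
    funext ω
    by_cases h : X (i + 1) ω ∈ Set.Ioc a b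
    · rw [Set.indicator_of_mem h, Set.indicator_of_mem (by exact h)]
    · rw [Set.indicator_of_notMem h, Set.indicator_of_notMem (by exact h)]
  rw [this]
  exact (measurable_pathWeight hX hY p i i).indicator (hX _ measurableSet_Ioc)

end Measurability

end PathWeight

/-! ### Counting processes, increments and local observation times -/

namespace ObservationScheme

variable {Ω : Type*} [m₀ : MeasurableSpace Ω] {h : ℕ → ℝ} (X : ObservationScheme Ω h)

section Counting

variable {n : ℕ} {l : Fin 2} {ω : Ω}

lemma time_strictMono (hn : 1 ≤ n) {i j : ℕ} (hij : i < j) (hj : j ≤ X.numObs n l ω) :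
    X.time n l i ω < X.time n l j ω := by
  induction j, hij using Nat.le_induction with
  | base => exact X.time_lt_succ n hn l ω i hj
  | succ j hj' ih => exact (ih (by omega)).trans (X.time_lt_succ n hn l ω j hj)

lemma time_mono (hn : 1 ≤ n) {i j : ℕ} (hij : i ≤ j) (hj : j ≤ X.numObs n l ω) :
    X.time n l i ω ≤ X.time n l j ω := by
  rcases hij.eq_or_lt with rfl | h
  · exact le_rfl
  · exact (X.time_strictMono hn h hj).le

lemma counting_le_numObs (n : ℕ) (l : Fin 2) (t : ℝ) (ω : Ω) :
    X.counting n l t ω ≤ X.numObs n l ω := by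
  refine (Finset.card_filter_le _ _).trans ?_
  simp

lemma le_counting_iff (hn : 1 ≤ n) {t : ℝ} (ht : 0 ≤ t) {i : ℕ} (hi : i ≤ X.numObs n l ω) :
    i ≤ X.counting n l t ω ↔ X.time n l i ω ≤ t := by
  constructor
  · intro hc
    by_contra hlt
    push Not at hlt
    have hi0 : i ≠ 0 := by
      rintro rfl
      rw [X.time_zero n hn] at hlt
      linarith
    have : X.counting n l t ω ≤ (Finset.Icc 1 (i - 1)).card := by
      refine Finset.card_le_card fun j hj => ?_
      simp only [Finset.mem_filter, Finset.mem_Icc] at hj ⊢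
      refine ⟨hj.1.1, ?_⟩
      by_contra hji
      have := X.time_mono (l := l) (ω := ω) hn (show i ≤ j by omega) hj.1.2
      linarith [hj.2]
    rw [Nat.card_Icc] at this
    omega
  · intro hle
    have : (Finset.Icc 1 i).card ≤ X.counting n l t ω := by
      refine Finset.card_le_card fun j hj => ?_
      simp only [Finset.mem_filter, Finset.mem_Icc] at hj ⊢
      exact ⟨⟨hj.1, hj.2.trans hi⟩, (X.time_mono hn hj.2 hi).trans hle⟩
    simpa using this

lemma counting_mono (n : ℕ) (l : Fin 2) (ω : Ω) {s t : ℝ} (hst : s ≤ t) :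
    X.counting n l s ω ≤ X.counting n l t ω :=
  Finset.card_le_card fun j hj => by
    simp only [Finset.mem_filter] at hj ⊢
    exact ⟨hj.1, hj.2.trans hst⟩

lemma counting_zero (hn : 1 ≤ n) : X.counting n l 0 ω = 0 := by
  by_contra hc
  have h1 := (X.le_counting_iff (l := l) (ω := ω) hn le_rfl (X.numObs_pos n hn l ω)).1
    (Nat.one_le_iff_ne_zero.2 hc)
  have h2 := X.time_lt_succ n hn l ω 0 (X.numObs_pos n hn l ω)
  rw [X.time_zero n hn] at h2
  simp only [zero_add] at h1 h2
  linarith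

lemma counting_of_le (hn : 1 ≤ n) {t : ℝ} (ht0 : 0 ≤ t) (ht : n * h n ≤ t) :
    X.counting n l t ω = X.numObs n l ω :=
  le_antisymm (X.counting_le_numObs _ _ _ _)
    ((X.le_counting_iff hn ht0 le_rfl).2 (by rwa [X.time_last n hn]))

lemma card_filter_Ioc_add_counting {s t : ℝ} (hst : s ≤ t) :
    ((Finset.Icc 1 (X.numObs n l ω)).filter fun i =>
      s < X.time n l i ω ∧ X.time n l i ω ≤ t).card + X.counting n l s ω =
      X.counting n l t ω := by
  unfold counting
  rw [← Finset.card_union_of_disjoint]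
  · congr 1
    ext i
    simp only [Finset.mem_union, Finset.mem_filter, Finset.mem_Icc]
    constructor
    · rintro (⟨h1, h2⟩ | ⟨h1, h2⟩)
      · exact ⟨h1, h2.2⟩
      · exact ⟨h1, h2.trans hst⟩
    · rintro ⟨h1, h2⟩
      rcases lt_or_ge s (X.time n l i ω) with h3 | h3
      · exact Or.inl ⟨h1, h3, h2⟩
      · exact Or.inr ⟨h1, h3⟩
  · rw [Finset.disjoint_left]
    intro i hi hi'
    simp only [Finset.mem_filter] at hi hi'
    linarith [hi.2.1, hi'.2]

lemma measurable_counting (n : ℕ) (l : Fin 2) (t : ℝ) : Measurable (X.counting n l t) := by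
  have h1 : Measurable fun p : ℕ × Ω =>
      ((Finset.Icc 1 p.1).filter fun i => X.time n l i p.2 ≤ t).card := by
    refine measurable_from_prod_countable_right fun m => ?_
    simp_rw [Finset.card_filter]
    refine Finset.measurable_sum _ fun i _ => ?_
    exact Measurable.ite (measurableSet_le (X.measurable_time n l i) measurable_const)
      measurable_const measurable_const
  exact h1.comp ((X.measurable_numObs n l).prodMk measurable_id)

end Counting

section Increments

variable {X}

lemma measurable_increment {n i j : ℕ} {s t : ℝ} (l : Fin 2) (hs : i * h n ≤ s) (hst : s ≤ t)
    (ht : t ≤ j * h n) :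
    Measurable[X.incrementSigma n i j] fun ω => X.counting n l t ω - X.counting n l s ω := by
  rcases hst.eq_or_lt with rfl | hst
  · simp only [le_refl, tsub_eq_zero_of_le]; exact measurable_const
  · rw [measurable_iff_comap_le]
    exact le_iSup_of_le l (le_iSup_of_le s (le_iSup_of_le t (le_iSup_of_le ⟨hs, hst, ht⟩ le_rfl)))

lemma incrementSigma_le (n i j : ℕ) : X.incrementSigma n i j ≤ m₀ := by
  refine iSup_le fun l => iSup_le fun s => iSup_le fun t => iSup_le fun _ => ?_
  rw [← measurable_iff_comap_le]
  exact (Measurable.of_discrete (f := fun p : ℕ × ℕ => p.1 - p.2)).comp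
    ((X.measurable_counting n l t).prodMk (X.measurable_counting n l s))

lemma incrementSigma_mono {n i j i' j' : ℕ} (hh : 0 ≤ h n) (hi : i' ≤ i) (hj : j ≤ j') :
    X.incrementSigma n i j ≤ X.incrementSigma n i' j' := by
  refine iSup_le fun l => iSup_le fun s => iSup_le fun t => iSup_le fun hst => ?_
  rw [← measurable_iff_comap_le]
  refine measurable_increment l (le_trans ?_ hst.1) hst.2.1.le (hst.2.2.trans ?_) <;> gcongr

/-- There are no increments between `i h_n` and `j h_n` if `j ≤ i`. -/
lemma incrementSigma_eq_bot {n i j : ℕ} (hh : 0 ≤ h n) (hij : j ≤ i) :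
    X.incrementSigma n i j = ⊥ := by
  refine le_bot_iff.1 (iSup_le fun l => iSup_le fun s => iSup_le fun t => iSup_le fun hst => ?_)
  have : (j : ℝ) * h n ≤ i * h n := by gcongr
  linarith [hst.1, hst.2.1, hst.2.2]

/-- In the definition of the mixing coefficient the indices avoid the two ends of the horizon; at
these ends the σ-algebras are trivial. -/
lemma mixingBound_mixingCoeff {P : Measure Ω} [IsProbabilityMeasure P] {n i j k : ℕ}
    (hh : 0 ≤ h n) (hijk : i + k ≤ j) (hfin : X.mixingCoeff P n k ≠ ⊤) :
    MixingBound P (X.incrementSigma n 0 i) (X.incrementSigma n j n)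
      (X.mixingCoeff P n k).toReal := by
  rcases Nat.eq_zero_or_pos i with rfl | hi
  · rw [incrementSigma_eq_bot hh le_rfl]
    exact mixingBound_bot_left ENNReal.toReal_nonneg
  rcases le_or_gt n j with hj | hj
  · rw [incrementSigma_eq_bot hh hj]
    exact mixingBound_bot_right ENNReal.toReal_nonneg
  intro A B hA hB
  rw [← ENNReal.ofReal_le_iff_le_toReal hfin]
  exact le_iSup_of_le i (le_iSup_of_le j (le_iSup_of_le ⟨hi, by omega, by omega, hj, hijk⟩
    (le_iSup_of_le A (le_iSup_of_le B (le_iSup_of_le ⟨hA, hB⟩ le_rfl)))))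

end Increments

section ExtendedTimes

/-- The observation times, continued by the constant `n h_n` after the last one. -/
noncomputable def extTime (n : ℕ) (l : Fin 2) (i : ℕ) (ω : Ω) : ℝ :=
  if i ≤ X.numObs n l ω then X.time n l i ω else n * h n

variable {n : ℕ} {l : Fin 2} {ω : Ω}

lemma extTime_of_le {i : ℕ} (hi : i ≤ X.numObs n l ω) : X.extTime n l i ω = X.time n l i ω :=
  if_pos hi

lemma extTime_of_ge (hn : 1 ≤ n) {i : ℕ} (hi : X.numObs n l ω ≤ i) :
    X.extTime n l i ω = n * h n := by
  rcases hi.eq_or_lt with rfl | hi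
  · rw [X.extTime_of_le le_rfl, X.time_last n hn]
  · exact if_neg (by omega)

lemma extTime_le_succ (hn : 1 ≤ n) (i : ℕ) : X.extTime n l i ω ≤ X.extTime n l (i + 1) ω := by
  rcases lt_or_ge i (X.numObs n l ω) with hi | hi
  · rw [X.extTime_of_le hi.le, X.extTime_of_le hi]
    exact (X.time_lt_succ n hn l ω i hi).le
  · rw [X.extTime_of_ge hn hi, X.extTime_of_ge hn (by omega)]

lemma extTime_mono (hn : 1 ≤ n) : Monotone fun i => X.extTime n l i ω :=
  monotone_nat_of_le_succ fun i => X.extTime_le_succ hn i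

lemma extTime_nonneg (hn : 1 ≤ n) (i : ℕ) : 0 ≤ X.extTime n l i ω := by
  have := X.extTime_mono (l := l) (ω := ω) hn (Nat.zero_le i)
  simp only [X.extTime_of_le (Nat.zero_le _), X.time_zero n hn] at this
  exact this

lemma extTime_le (hn : 1 ≤ n) (i : ℕ) : X.extTime n l i ω ≤ n * h n := by
  have := X.extTime_mono (l := l) (ω := ω) hn (le_max_left i (X.numObs n l ω))
  simp only [X.extTime_of_ge hn (le_max_right i (X.numObs n l ω))] at this
  exact this

lemma measurable_extTime (n : ℕ) (l : Fin 2) (i : ℕ) : Measurable (X.extTime n l i) :=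
  Measurable.ite (measurableSet_le measurable_const (X.measurable_numObs n l))
    (X.measurable_time n l i) measurable_const

/-- Beyond the last observation both sides fail, as the continued times equal `n h_n > t`. -/
lemma le_counting_iff_extTime_le (hn : 1 ≤ n) {t : ℝ} (ht : 0 ≤ t) (htn : t < n * h n) {i : ℕ} :
    i ≤ X.counting n l t ω ↔ X.extTime n l i ω ≤ t := by
  rcases le_or_gt i (X.numObs n l ω) with hi | hi
  · rw [X.le_counting_iff hn ht hi, X.extTime_of_le hi]
  · rw [X.extTime_of_ge hn hi.le]
    have := X.counting_le_numObs n l t ω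
    constructor
    · intro h1; omega
    · intro h1; linarith

/-- The event that each stretch of `d` consecutive steps of length `h_n` contains an observation of
either component. -/
def meshEvent (n d : ℕ) : Set Ω :=
  {ω | ∀ (l : Fin 2) (v : ℕ), v + d ≤ n →
    X.counting n l (v * h n) ω < X.counting n l ((v * h n) + d * h n) ω}

/-- A longer interval would contain a stretch of `d` grid steps without observations. -/
lemma meshLE_extTime (hn : 1 ≤ n) (hh : 0 < h n) {d : ℕ} (hd : 1 ≤ d) (hω : ω ∈ X.meshEvent n d) :
    MeshLE (fun i => X.extTime n l i ω) (2 * d * h n) := by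
  intro i
  refine ⟨X.extTime_le_succ hn i, ?_⟩
  by_contra hlt
  push Not at hlt
  have hd' : (1 : ℝ) ≤ d := by exact_mod_cast hd
  have hdh : h n ≤ d * h n := by nlinarith
  have hi : i + 1 ≤ X.numObs n l ω := by
    by_contra hc
    rw [X.extTime_of_ge hn (show X.numObs n l ω ≤ i by omega),
      X.extTime_of_ge hn (show X.numObs n l ω ≤ i + 1 by omega)] at hlt
    linarith
  -- the first grid point after the left endpoint
  set v := ⌈X.extTime n l i ω / h n⌉₊ with hv
  have hpos := X.extTime_nonneg (l := l) (ω := ω) hn i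
  have v1 : X.extTime n l i ω ≤ v * h n := by
    rw [← div_le_iff₀ hh]; exact Nat.le_ceil _
  have v2 : v * h n < X.extTime n l i ω + h n := by
    have : (v : ℝ) < X.extTime n l i ω / h n + 1 := Nat.ceil_lt_add_one (by positivity)
    calc (v : ℝ) * h n < (X.extTime n l i ω / h n + 1) * h n := by gcongr
      _ = _ := by field_simp
  have v3 : v * h n + d * h n < X.extTime n l (i + 1) ω := by linarith
  have v4 : v + d ≤ n := by
    have := X.extTime_le (l := l) (ω := ω) hn (i + 1)
    have h5 : ((v + d : ℕ) : ℝ) * h n < n * h n := by push_cast; linarith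
    have := lt_of_mul_lt_mul_right h5 hh.le
    exact_mod_cast this.le
  have hlt' := hω l v v4
  rw [X.extTime_of_le hi] at v3
  rw [X.extTime_of_le (by omega)] at v1
  have c1 := (X.le_counting_iff hn (by positivity) (by omega)).2 v1
  have c2 := (X.le_counting_iff hn (t := v * h n + d * h n) (by positivity) hi).1
    (show i + 1 ≤ X.counting n l (v * h n + d * h n) ω by omega)
  linarith

/-- The `i`-th observation time after `a h_n`, clamped to `[a h_n, c h_n]`. -/
noncomputable def localTime (n : ℕ) (l : Fin 2) (a c i : ℕ) (ω : Ω) : ℝ :=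
  max (a * h n) (min (c * h n) (X.extTime n l (X.counting n l (a * h n) ω + i) ω))

/-- The clamped times are functions of the increments of the counting process over
`[a h_n, c h_n]`. -/
lemma measurable_localTime (hn : 1 ≤ n) (hh : 0 < h n) {a c : ℕ} (hac : a ≤ c) (hcn : c ≤ n)
    (i : ℕ) : Measurable[X.incrementSigma n a c] (X.localTime n l a c i) := by
  have hac' : (a : ℝ) * h n ≤ c * h n := by gcongr
  have hcn' : (c : ℝ) * h n ≤ n * h n := by gcongr
  refine @measurable_of_Iic _ _ _ _ _ (X.incrementSigma n a c) _ _ _ _ fun t => ?_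
  rcases lt_or_ge t (a * h n) with ht | ht
  · -- for `t` below, inside and above the window the event is empty, a condition on an
    -- increment, and sure
    convert @MeasurableSet.empty _ (X.incrementSigma n a c)
    rw [Set.eq_empty_iff_forall_notMem]
    intro ω hω
    have : X.localTime n l a c i ω ≤ t := hω
    exact absurd ((le_max_left _ _).trans this) (not_le.2 ht)
  rcases le_or_gt (c * h n) t with ht' | ht'
  · convert @MeasurableSet.univ _ (X.incrementSigma n a c)
    rw [Set.eq_univ_iff_forall]
    intro ω
    exact max_le ht ((min_le_left _ _).trans ht')
  · have ha0 : 0 ≤ (a : ℝ) * h n := by positivity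
    convert measurable_increment (X := X) (j := c) l le_rfl ht ht'.le (measurableSet_Ici (a := i))
      using 1
    ext ω
    simp only [Set.mem_preimage, Set.mem_Iic, Set.mem_Ici, localTime]
    have hm := X.counting_mono n l ω ht
    rw [max_le_iff, min_le_iff, ← X.le_counting_iff_extTime_le hn (ha0.trans ht) (by linarith)]
    constructor
    · rintro ⟨-, h1 | h1⟩
      · linarith
      · omega
    · intro h1
      exact ⟨ht, Or.inr (by omega)⟩

lemma meshLE_localTime {D : ℝ} (a c : ℕ) (hm : MeshLE (fun i => X.extTime n l i ω) D) :
    MeshLE (fun i => X.localTime n l a c i ω) D := by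
  intro i
  have h1 := hm (X.counting n l (a * h n) ω + i)
  have hD := hm.nonneg
  simp only [localTime, ← add_assoc]
  constructor
  · exact max_le_max le_rfl (min_le_min le_rfl h1.1)
  · refine max_le ((le_max_left _ _).trans (le_add_of_nonneg_right hD)) ?_
    refine le_trans ?_ (add_le_add_left (le_max_right _ _) D)
    rw [← min_add_add_right]
    exact min_le_min (by linarith) h1.2

/-- Clamping does not affect the times between two levels inside the window. At an end of the
horizon no margin is needed, since there are no times beyond it. -/
lemma agreesBetween_localTime (hn : 1 ≤ n) (hh : 0 < h n) {a c : ℕ} {σ η : ℝ} (han : a < n)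
    (ha : a * h n < σ ∨ a = 0) (hc : η < c * h n ∨ c = n) :
    AgreesBetween (fun i => X.extTime n l i ω) (fun i => X.localTime n l a c i ω)
      (X.counting n l (a * h n) ω) σ η := by
  refine ⟨fun j h1 h2 => ?_, fun j h1 h2 => ?_, fun i hi => ?_⟩
  · have e1 : a * h n ≤ X.extTime n l (X.counting n l (a * h n) ω + j) ω := by
      rcases ha with ha | rfl
      · linarith
      · simpa using X.extTime_nonneg hn _
    have e2 : X.extTime n l (X.counting n l (a * h n) ω + j) ω ≤ c * h n := by
      rcases hc with hc | rfl
      · linarith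
      · exact X.extTime_le hn _
    simp only [localTime]
    rw [min_eq_right e2, max_eq_right e1]
  · simp only [localTime] at h1 h2 ⊢
    set z := X.extTime n l (X.counting n l (a * h n) ω + j) ω with hz
    have e2 : min (c * h n) z = z := by
      refine min_eq_right ?_
      rcases hc with hc | rfl
      · by_contra hlt
        push Not at hlt
        rw [min_eq_left hlt.le] at h2
        linarith [le_max_right (a * h n) (c * h n)]
      · exact X.extTime_le hn _
    rw [e2] at h1 ⊢
    refine max_eq_right ?_
    rcases ha with ha | rfl
    · by_contra hlt
      push Not at hlt
      rw [max_eq_left hlt.le] at h1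
      linarith
    · simpa using X.extTime_nonneg hn _
  · rcases ha with ha | rfl
    · have : (a : ℝ) * h n < n * h n := by gcongr
      exact ((X.le_counting_iff_extTime_le hn (by positivity) this).1 hi.le).trans_lt ha
    · simp [X.counting_zero hn] at hi

end ExtendedTimes

end ObservationScheme

/-! ### Good events and sums over blocks -/

namespace ObservationScheme

variable {Ω : Type*} [m₀ : MeasurableSpace Ω] {h : ℕ → ℝ} (X : ObservationScheme Ω h)

/-- The number of observations of component `l` in `(u h_n, (u + 1) h_n]`. -/
noncomputable def unitCount (n : ℕ) (l : Fin 2) (u : ℕ) (ω : Ω) : ℕ :=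
  X.counting n l (u * h n + h n) ω - X.counting n l (u * h n) ω

lemma measurable_unitCount (n : ℕ) (l : Fin 2) (u : ℕ) : Measurable (X.unitCount n l u) :=
  (Measurable.of_discrete (f := fun p : ℕ × ℕ => p.1 - p.2)).comp
    ((X.measurable_counting n l _).prodMk (X.measurable_counting n l _))

/-- The event that the observations are dense on the scale `b h_n`, and that no step of length `h_n`
contains more than `b` observations of component `l`. -/
def goodEvent (n : ℕ) (l : Fin 2) (b : ℕ) : Set Ω :=
  X.meshEvent n b ∩ {ω | ∀ u < n, X.unitCount n l u ω ≤ b}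

lemma measurableSet_goodEvent (n : ℕ) (l : Fin 2) (b : ℕ) :
    MeasurableSet (X.goodEvent n l b) := by
  refine MeasurableSet.inter ?_ ?_
  · simp only [meshEvent, Set.ofPred_forall]
    exact MeasurableSet.iInter fun l => MeasurableSet.iInter fun v => MeasurableSet.iInter fun _ =>
      measurableSet_lt (X.measurable_counting n l _) (X.measurable_counting n l _)
  · simp only [Set.ofPred_forall]
    exact MeasurableSet.iInter fun u => MeasurableSet.iInter fun _ =>
      measurableSet_le (X.measurable_unitCount n l u) measurable_const

variable {X} {P : Measure Ω}

lemma CondMixing.exists_le {Q : ℕ} (hmix : X.CondMixing P Q) :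
    ∃ C : ℝ, 0 ≤ C ∧ ∀ n, 1 ≤ n → ∀ k, X.mixingCoeff P n k ≠ ⊤ ∧
      (X.mixingCoeff P n k).toReal ≤ C / ((k : ℝ) + 1) ^ Q := by
  obtain ⟨C, hC⟩ := hmix
  refine ⟨C, C.2, fun n hn k => ?_⟩
  have h1 : ((k : ℝ≥0∞) + 1) ^ Q * X.mixingCoeff P n k ≤ C := by
    have := (ENNReal.le_tsum k).trans (hC n hn)
    simpa only [ENNReal.rpow_natCast] using this
  have hk0 : ((k : ℝ≥0∞) + 1) ^ Q ≠ 0 := pow_ne_zero _ (by simp)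
  have hfin : X.mixingCoeff P n k ≠ ⊤ := by
    intro htop
    rw [htop, ENNReal.mul_top hk0] at h1
    exact absurd h1 (by simp)
  refine ⟨hfin, ?_⟩
  rw [le_div_iff₀ (by positivity), mul_comm]
  have := ENNReal.toReal_mono ENNReal.coe_ne_top h1
  rw [ENNReal.toReal_mul, ENNReal.toReal_pow, ENNReal.toReal_add (by simp) (by simp)] at this
  simpa using this

/-- The moment bound on the steps `(u h_n, (u + 1) h_n]` of the grid. -/
lemma CondB1.exists_lintegral_le {q : ℕ} (hB1 : X.CondB1 P q) (h_pos : ∀ n, 1 ≤ n → 0 < h n) :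
    ∃ C : ℝ≥0, ∀ n, 1 ≤ n → ∀ l, ∀ u < n,
      ∫⁻ ω, (X.unitCount n l u ω : ℝ≥0∞) ^ q ∂P ≤ C := by
  obtain ⟨C, hC⟩ := hB1
  refine ⟨C, fun n hn l u hu => ?_⟩
  have hh := h_pos n hn
  have := hC n hn l (u * h n) (by positivity) ?_
  · simpa only [ENNReal.rpow_natCast, unitCount] using this
  · have : (u : ℝ) + 1 ≤ n := by exact_mod_cast hu
    gcongr
    linarith

lemma CondB1.exists_integral_le {q : ℕ} (hB1 : X.CondB1 P q) (h_pos : ∀ n, 1 ≤ n → 0 < h n) :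
    ∃ C : ℝ, 0 ≤ C ∧ ∀ n, 1 ≤ n → ∀ l, ∀ u < n,
      Integrable (fun ω => (X.unitCount n l u ω : ℝ) ^ q) P ∧
      ∫ ω, (X.unitCount n l u ω : ℝ) ^ q ∂P ≤ C := by
  obtain ⟨C, hC⟩ := hB1.exists_lintegral_le h_pos
  refine ⟨C, C.2, fun n hn l u hu => ?_⟩
  have hm : Measurable fun ω => (X.unitCount n l u ω : ℝ) ^ q :=
    (measurable_from_top.comp (X.measurable_unitCount n l u)).pow_const q
  have e : ∀ ω, ENNReal.ofReal ((X.unitCount n l u ω : ℝ) ^ q)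
      = (X.unitCount n l u ω : ℝ≥0∞) ^ q := fun ω => by
    rw [ENNReal.ofReal_pow (by positivity), ENNReal.ofReal_natCast]
  have hle := hC n hn l u hu
  simp_rw [← e] at hle
  have hnn : 0 ≤ᵐ[P] fun ω => (X.unitCount n l u ω : ℝ) ^ q :=
    ae_of_all _ fun ω => by positivity
  refine ⟨⟨hm.aestronglyMeasurable, ?_⟩, ?_⟩
  · rw [hasFiniteIntegral_iff_ofReal hnn]
    exact hle.trans_lt ENNReal.coe_lt_top
  · rw [integral_eq_lintegral_of_nonneg_ae hnn hm.aestronglyMeasurable]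
    exact ENNReal.toReal_le_of_le_ofReal C.2 (by simpa using hle)

variable [IsProbabilityMeasure P]

section Moments

/-- The good event fails with a probability smaller than any power of `1 / b`, up to a factor `n`
for the number of steps. -/
lemma exists_measureReal_goodEvent_compl_le (h_pos : ∀ n, 1 ≤ n → 0 < h n) (Q : ℕ)
    (hB1 : X.CondB1 P Q) (hB2 : X.CondB2 P Q) :
    ∃ C : ℝ, 0 ≤ C ∧ ∀ᶠ b : ℕ in atTop, ∀ n, 1 ≤ n → ∀ l,
      P.real (X.goodEvent n l b)ᶜ ≤ C * n / b ^ Q := by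
  obtain ⟨C₁, hC₁0, hC₁⟩ := hB1.exists_integral_le h_pos
  obtain ⟨C₂, hC₂⟩ := hB2
  refine ⟨C₁ + 4 * |C₂|, by positivity, ?_⟩
  filter_upwards [tendsto_natCast_atTop_atTop.eventually hC₂, eventually_ge_atTop 1]
    with b hb hb1 n hn l
  have hh := h_pos n hn
  have hbQ : (0 : ℝ) < (b : ℝ) ^ Q := by positivity
  have hsub : (X.goodEvent n l b)ᶜ ⊆
      (⋃ l' ∈ (Finset.univ : Finset (Fin 2)), ⋃ v ∈ (Finset.range (n + 1)).filter (· + b ≤ n),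
        {ω | X.counting n l' (v * h n + b * h n) ω - X.counting n l' (v * h n) ω = 0}) ∪
      ⋃ u ∈ Finset.range n, {ω | (b : ℝ) ^ Q ≤ (X.unitCount n l u ω : ℝ) ^ Q} := by
    intro ω hω
    simp only [goodEvent, meshEvent, Set.mem_compl_iff, Set.mem_inter_iff, Set.mem_ofPred_eq,
      not_and_or, not_forall, not_lt, not_le] at hω
    rcases hω with ⟨l', v, hv, hle⟩ | ⟨u, hu, hlt⟩
    · left
      simp only [Set.mem_iUnion, Finset.mem_filter, Finset.mem_range, Set.mem_ofPred_eq]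
      exact ⟨l', Finset.mem_univ _, v, ⟨by omega, hv⟩, by omega⟩
    · right
      simp only [Set.mem_iUnion, Finset.mem_range, Set.mem_ofPred_eq]
      refine ⟨u, hu, ?_⟩
      gcongr
  have h1 : ∀ l', ∀ v ∈ (Finset.range (n + 1)).filter (· + b ≤ n),
      P.real {ω | X.counting n l' (v * h n + b * h n) ω - X.counting n l' (v * h n) ω = 0}
        ≤ |C₂| / b ^ Q := by
    intro l' v hv
    have hv' : (v : ℝ) + b ≤ n := by exact_mod_cast (Finset.mem_filter.1 hv).2
    have := hb n hn l' (v * h n) (by positivity) (by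
      rw [← sub_mul]; gcongr; linarith)
    rw [Real.rpow_natCast] at this
    rw [le_div_iff₀ hbQ, mul_comm]
    exact this.trans (le_abs_self _)
  have h2 : ∀ u ∈ Finset.range n, P.real {ω | (b : ℝ) ^ Q ≤ (X.unitCount n l u ω : ℝ) ^ Q}
      ≤ C₁ / b ^ Q := by
    intro u hu
    obtain ⟨hi, hle⟩ := hC₁ n hn l u (Finset.mem_range.1 hu)
    rw [le_div_iff₀ hbQ, mul_comm]
    exact (mul_meas_ge_le_integral_of_nonneg (ae_of_all _ fun ω => by positivity) hi _).trans hle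
  have hn' : (1 : ℝ) ≤ n := by exact_mod_cast hn
  calc P.real (X.goodEvent n l b)ᶜ ≤ _ := measureReal_mono hsub
    _ ≤ _ := measureReal_union_le _ _
    _ ≤ (∑ l' : Fin 2, ∑ v ∈ (Finset.range (n + 1)).filter (· + b ≤ n), |C₂| / b ^ Q)
        + ∑ u ∈ Finset.range n, C₁ / b ^ Q := by
        refine add_le_add ?_ ?_
        · refine (measureReal_biUnion_finset_le _ _).trans (Finset.sum_le_sum fun l' _ => ?_)
          exact (measureReal_biUnion_finset_le _ _).trans (Finset.sum_le_sum (h1 l'))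
        · exact (measureReal_biUnion_finset_le _ _).trans (Finset.sum_le_sum h2)
    _ ≤ 2 * ((n + 1) * (|C₂| / b ^ Q)) + n * (C₁ / b ^ Q) := by
        simp only [Finset.sum_const, nsmul_eq_mul, Finset.card_univ, Fintype.card_fin,
          Finset.card_range, Nat.cast_ofNat]
        gcongr
        have := Finset.card_filter_le (Finset.range (n + 1)) (· + b ≤ n)
        rw [Finset.card_range] at this
        exact_mod_cast this
    _ ≤ 2 * ((n + n) * (|C₂| / b ^ Q)) + n * (C₁ / b ^ Q) := by gcongr
    _ = (C₁ + 4 * |C₂|) * n / b ^ Q := by ring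

end Moments

section BlockSums

lemma sum_range_mul_eq_sum_residues (m N : ℕ) (g : ℕ → ℝ) :
    ∑ t ∈ Finset.range (m * N), g t =
      ∑ r ∈ Finset.range m, ∑ j ∈ Finset.range N, g (r + j * m) := by
  induction N with
  | zero => simp
  | succ N ih =>
    rw [mul_add, mul_one, Finset.sum_range_add, ih, ← Finset.sum_add_distrib]
    refine Finset.sum_congr rfl fun r _ => ?_
    rw [Finset.sum_range_succ, add_comm (m * N) r, mul_comm m N]

lemma sum_Ico_eq_sum_residues {lo hi m : ℕ} (hm : 1 ≤ m) (f : ℕ → ℝ) :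
    ∑ u ∈ Finset.Ico lo hi, f u = ∑ r ∈ Finset.range m, ∑ j ∈ Finset.range (hi - lo),
      if lo + r + j * m < hi then f (lo + r + j * m) else 0 := by
  have h1 := sum_range_mul_eq_sum_residues m (hi - lo)
    (fun t => if lo + t < hi then f (lo + t) else 0)
  simp only [← add_assoc] at h1
  rw [← h1, Finset.sum_Ico_eq_sum_range]
  have hsub : Finset.range (hi - lo) ⊆ Finset.range (m * (hi - lo)) := by
    refine Finset.range_subset_range.2 ?_
    exact Nat.le_mul_of_pos_left _ hm
  rw [← Finset.sum_subset hsub]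
  · refine Finset.sum_congr rfl fun t ht => ?_
    rw [if_pos]
    have := Finset.mem_range.1 ht
    omega
  · intro t _ ht
    rw [if_neg]
    have := Finset.mem_range.not.1 ht
    omega

/-- Deviation inequality for sums of bounded variables `Z_u` that depend on the increments in
a window of `w` steps around step `u`. The steps are distributed over residue classes modulo
`2 w + 1 + b`, within which the windows are `b` steps apart. -/
lemma measureReal_le_abs_sum_le {n w b : ℕ} (q : ℕ) (hh : 0 < h n)
    (hα : X.mixingCoeff P n b ≠ ⊤) {Z : ℕ → Ω → ℝ}
    (hZm : ∀ u < n, Measurable[X.incrementSigma n (u - w) (min n (u + 1 + w))] (Z u))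
    (hZ0 : ∀ u < n, ∀ ω, 0 ≤ Z u ω) (hZb : ∀ u < n, ∀ ω, Z u ω ≤ b)
    {lo hi : ℕ} (hhi : hi ≤ n) {c : ℝ} (hc : 0 < c) :
    P.real {ω | c ≤ |∑ u ∈ Finset.Ico lo hi, (Z u ω - ∫ ω', Z u ω' ∂P)|} ≤
      ((2 * w + 1 + b : ℕ) : ℝ) * (((2 * w + 1 + b : ℕ) : ℝ) / c) ^ (2 * q) * ((b : ℝ) ^ (2 * q) *
        (((hi - lo : ℕ) : ℝ) ^ q * (q : ℝ) ^ (2 * q) + ((hi - lo : ℕ) : ℝ) ^ (2 * q) *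
          (8 * (X.mixingCoeff P n b).toReal))) := by
  set m := 2 * w + 1 + b with hm
  set N := hi - lo with hN
  set α := (X.mixingCoeff P n b).toReal with hαdef
  have hm1 : 1 ≤ m := by omega
  have hm0 : (0 : ℝ) < m := by exact_mod_cast hm1
  have hZmeas : ∀ u < n, Measurable (Z u) := fun u hu => (hZm u hu).mono (incrementSigma_le _ _ _)
    le_rfl
  have hZi : ∀ u < n, Integrable (Z u) P := fun u hu =>
    Integrable.of_bound (hZmeas u hu).aestronglyMeasurable (b : ℝ) (ae_of_all _ fun ω => by
      rw [Real.norm_eq_abs, abs_of_nonneg (hZ0 u hu ω)]; exact hZb u hu ω)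
  have hEZ : ∀ u < n, 0 ≤ ∫ ω', Z u ω' ∂P ∧ ∫ ω', Z u ω' ∂P ≤ b := by
    intro u hu
    refine ⟨integral_nonneg (hZ0 u hu), ?_⟩
    have := integral_mono (hZi u hu) (integrable_const (μ := P) (b : ℝ)) (hZb u hu)
    simpa using this
  set e : ℕ → ℝ := fun u => ∫ ω', Z u ω' ∂P with he
  set Y : ℕ → ℕ → Ω → ℝ := fun r j ω =>
    if lo + r + j * m < hi then Z (lo + r + j * m) ω - e (lo + r + j * m) else 0
    with hY
  let G : ℕ → ℕ → MeasurableSpace Ω := fun i j => X.incrementSigma n i j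
  have hYm : ∀ (r j : ℕ) (m' : MeasurableSpace Ω),
      (lo + r + j * m < hi → G (lo + r + j * m - w) (min n (lo + r + j * m + 1 + w)) ≤ m') →
      Measurable[m'] (Y r j) := by
    intro r j m' hle
    by_cases hlt : lo + r + j * m < hi
    · have : Y r j = fun ω => Z (lo + r + j * m) ω - e (lo + r + j * m) := by
        funext ω; simp only [hY, if_pos hlt]
      rw [this]
      have hz : Measurable[m'] (Z (lo + r + j * m)) := fun s hs =>
        hle hlt _ (hZm _ (hlt.trans_le hhi) hs)
      exact @Measurable.sub_const ℝ Ω _ _ m' _ _ hz _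
    · have : Y r j = fun _ => 0 := by
        funext ω; simp only [hY, if_neg hlt]
      rw [this]; exact measurable_const
  have hYb : ∀ r j ω, |Y r j ω| ≤ b := by
    intro r j ω
    simp only [hY]
    split_ifs with hlt
    · have h1 := hZ0 _ (hlt.trans_le hhi) ω
      have h2 := hZb _ (hlt.trans_le hhi) ω
      obtain ⟨h3, h4⟩ := hEZ _ (hlt.trans_le hhi)
      rw [abs_le]; constructor <;> linarith
    · simp
  have hYmeas : ∀ r j, Measurable (Y r j) := fun r j =>
    hYm r j m₀ fun _ => incrementSigma_le _ _ _
  have hY0 : ∀ r j, ∫ ω, Y r j ω ∂P = 0 := by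
    intro r j
    simp only [hY]
    split_ifs with hlt
    · rw [integral_sub (hZi _ (hlt.trans_le hhi)) (integrable_const _)]
      simp [he]
    · simp
  -- the past of the `j`-th window of a residue class
  let 𝓛 : ℕ → ℕ → MeasurableSpace Ω := fun r j =>
    Nat.casesOn j ⊥ fun j' => X.incrementSigma n 0 (lo + r + j' * m + 1 + w)
  have hmoment : ∀ r, ∫ ω, (∑ j ∈ Finset.range N, Y r j ω) ^ (2 * q) ∂P ≤
      (b : ℝ) ^ (2 * q) * ((N : ℝ) ^ q * (q : ℝ) ^ (2 * q) + (N : ℝ) ^ (2 * q) * (8 * α)) := by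
    intro r
    refine integral_sum_pow_le (𝓛 := 𝓛 r)
      (𝓡 := fun j => X.incrementSigma n (lo + r + j * m - w) n) (Nat.cast_nonneg _)
      ENNReal.toReal_nonneg ?_ (fun j => incrementSigma_le _ _ _) ?_ ?_ (hYb r) (hY0 r) ?_
    · rintro (_ | j)
      · exact bot_le
      · exact incrementSigma_le _ _ _
    · -- a window ends at most `w + 1` steps after its base step
      rintro (_ | i) j hij
      · omega
      · refine hYm r j _ fun _ => incrementSigma_mono hh.le (Nat.zero_le _) ?_
        refine (min_le_right _ _).trans ?_
        have : j * m ≤ i * m := Nat.mul_le_mul_right _ (by omega)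
        omega
    · intro i j hij
      refine hYm r j _ fun _ => incrementSigma_mono hh.le ?_ (min_le_left _ _)
      have : i * m ≤ j * m := Nat.mul_le_mul_right _ hij
      omega
    · rintro (_ | j)
      · exact mixingBound_bot_left ENNReal.toReal_nonneg
      · refine mixingBound_mixingCoeff hh.le ?_ hα
        have : (j + 1) * m = j * m + m := by ring
        omega
  set c' := c / m with hc'
  have hc'0 : 0 < c' := by positivity
  have hsub : {ω | c ≤ |∑ u ∈ Finset.Ico lo hi, (Z u ω - ∫ ω', Z u ω' ∂P)|} ⊆
      ⋃ r ∈ Finset.range m,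
        {ω | c' ^ (2 * q) ≤ (∑ j ∈ Finset.range N, Y r j ω) ^ (2 * q)} := by
    intro ω hω
    by_contra hcon
    simp only [Set.mem_iUnion, Set.mem_ofPred_eq, not_exists, not_le, Finset.mem_range] at hcon hω
    have hlt : ∀ r ∈ Finset.range m, |∑ j ∈ Finset.range N, Y r j ω| < c' := by
      intro r hr
      have := hcon r (Finset.mem_range.1 hr)
      rw [← (even_two_mul q).pow_abs] at this
      exact lt_of_pow_lt_pow_left₀ _ hc'0.le this
    rw [sum_Ico_eq_sum_residues hm1] at hω
    have h1 : |∑ r ∈ Finset.range m, ∑ j ∈ Finset.range N, Y r j ω| < ∑ r ∈ Finset.range m, c' :=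
      (Finset.abs_sum_le_sum_abs _ _).trans_lt
        (Finset.sum_lt_sum_of_nonempty ⟨0, Finset.mem_range.2 hm1⟩ hlt)
    rw [Finset.sum_const, Finset.card_range, nsmul_eq_mul, hc', mul_div_cancel₀ _ hm0.ne'] at h1
    linarith
  refine (measureReal_mono hsub (measure_ne_top _ _)).trans
    ((measureReal_biUnion_finset_le _ _).trans ?_)
  have hone : ∀ r ∈ Finset.range m,
      P.real {ω | c' ^ (2 * q) ≤ (∑ j ∈ Finset.range N, Y r j ω) ^ (2 * q)} ≤
      ((m : ℝ) / c) ^ (2 * q) * ((b : ℝ) ^ (2 * q) *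
        ((N : ℝ) ^ q * (q : ℝ) ^ (2 * q) + (N : ℝ) ^ (2 * q) * (8 * α))) := by
    intro r _
    have hint : Integrable (fun ω => (∑ j ∈ Finset.range N, Y r j ω) ^ (2 * q)) P := by
      refine Integrable.of_bound ((Finset.measurable_sum _ fun j _ =>
        hYmeas r j).pow_const _).aestronglyMeasurable ((N * b : ℝ) ^ (2 * q))
        (ae_of_all _ fun ω => ?_)
      rw [norm_pow]
      refine pow_le_pow_left₀ (norm_nonneg _) ?_ _
      refine (norm_sum_le _ _).trans ((Finset.sum_le_card_nsmul _ _ (b : ℝ) fun j _ => ?_).trans ?_)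
      · exact hYb r j ω
      · simp
    have := mul_meas_ge_le_integral_of_nonneg (μ := P)
      (ae_of_all _ fun ω => (even_two_mul q).pow_nonneg _) hint (c' ^ (2 * q))
    have h3 := this.trans (hmoment r)
    have h4 : ((m : ℝ) / c) ^ (2 * q) = 1 / c' ^ (2 * q) := by
      rw [hc', ← one_div_pow, one_div_div]
    rw [h4, one_div, ← div_eq_inv_mul, le_div_iff₀ (by positivity), mul_comm]
    exact h3
  refine (Finset.sum_le_sum hone).trans_eq ?_
  rw [Finset.sum_const, Finset.card_range, nsmul_eq_mul, mul_assoc]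

end BlockSums

end ObservationScheme

/-! ### Local cumulative quantities -/

namespace ObservationScheme

variable {Ω : Type*} [m₀ : MeasurableSpace Ω] {h : ℕ → ℝ} (X : ObservationScheme Ω h)

/-- A nondecreasing process dominated by the counting process of component `l`, whose increment over
one step of length `h_n` depends only on the observations within `c d` steps as soon as there are
observations in each stretch of `d` steps. -/
structure IsLocalCumulative (l : Fin 2) (c : ℕ) (A : ℕ → ℝ → Ω → ℝ) : Prop where
  measurable : ∀ n t, Measurable (A n t)
  mono : ∀ {n}, 1 ≤ n → ∀ {s t} ω, 0 ≤ s → s ≤ t → A n s ω ≤ A n t ω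
  sub_le : ∀ {n}, 1 ≤ n → ∀ {s t} ω, 0 ≤ s → s ≤ t →
    A n t ω - A n s ω ≤ (X.counting n l t ω : ℝ) - X.counting n l s ω
  exists_local : ∀ {n d u}, 1 ≤ n → 1 ≤ d → u < n → ∃ Z : Ω → ℝ,
    Measurable[X.incrementSigma n (u - c * d) (min n (u + 1 + c * d))] Z ∧
      ∀ ω ∈ X.meshEvent n d, A n (u * h n + h n) ω - A n (u * h n) ω = Z ω

variable {X}

lemma cast_unitCount {n : ℕ} (hh : 0 ≤ h n) (l : Fin 2) (u : ℕ) (ω : Ω) :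
    (X.unitCount n l u ω : ℝ) =
      (X.counting n l (u * h n + h n) ω : ℝ) - X.counting n l (u * h n) ω :=
  Nat.cast_sub (X.counting_mono n l ω (by linarith))

namespace IsLocalCumulative

variable {l : Fin 2} {c : ℕ} {A : ℕ → ℝ → Ω → ℝ} (hA : X.IsLocalCumulative l c A) {n b : ℕ}

include hA

lemma step_nonneg (hn : 1 ≤ n) (hh : 0 < h n) (u : ℕ) (ω : Ω) :
    0 ≤ A n (u * h n + h n) ω - A n (u * h n) ω :=
  sub_nonneg.2 (hA.mono hn ω (by positivity) (by linarith))

lemma step_le (hn : 1 ≤ n) (hh : 0 < h n) (u : ℕ) (ω : Ω) :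
    A n (u * h n + h n) ω - A n (u * h n) ω ≤ X.unitCount n l u ω := by
  rw [cast_unitCount hh.le]
  exact hA.sub_le hn ω (by positivity) (by linarith)

/-- On the good event the increments over one step are given by bounded local variables. -/
lemma exists_truncation (hn : 1 ≤ n) (hh : 0 < h n) (hb : 1 ≤ b) :
    ∃ Z : ℕ → Ω → ℝ, ∀ u < n,
      Measurable[X.incrementSigma n (u - c * b) (min n (u + 1 + c * b))] (Z u) ∧
      (∀ ω, 0 ≤ Z u ω) ∧ (∀ ω, Z u ω ≤ b) ∧
      ∀ ω ∈ X.goodEvent n l b, A n (u * h n + h n) ω - A n (u * h n) ω = Z u ω := by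
  choose Z hZm hZ using fun u : Fin n => hA.exists_local hn hb u.2
  refine ⟨fun u ω => if hu : u < n then max 0 (min b (Z ⟨u, hu⟩ ω)) else 0, fun u hu => ?_⟩
  simp only [dif_pos hu]
  refine ⟨?_, fun ω => le_max_left _ _, fun ω => max_le (Nat.cast_nonneg _) (min_le_left _ _), ?_⟩
  · exact measurable_const.max (measurable_const.min (hZm ⟨u, hu⟩))
  · intro ω hω
    have h1 := hZ ⟨u, hu⟩ ω hω.1
    simp only at h1
    rw [← h1, min_eq_right, max_eq_right (hA.step_nonneg hn hh u ω)]
    exact (hA.step_le hn hh u ω).trans (by exact_mod_cast hω.2 u hu)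

/-- An increment over `(s, t]` differs from the sum of the increments over the grid steps that
meet `(s, t]` by at most the contributions of the first and the last step. -/
lemma abs_increment_sub_sum_le (hn : 1 ≤ n) (hh : 0 < h n) {s t : ℝ} (hs : 0 ≤ s) (hst : s < t)
    (ω : Ω) :
    |A n t ω - A n s ω - ∑ u ∈ Finset.Ico ⌊s / h n⌋₊ ⌈t / h n⌉₊,
      (A n (u * h n + h n) ω - A n (u * h n) ω)| ≤
      X.unitCount n l ⌊s / h n⌋₊ ω + X.unitCount n l (⌈t / h n⌉₊ - 1) ω := by
  set lo := ⌊s / h n⌋₊ with hlo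
  have ht : 0 < t := hs.trans_lt hst
  obtain ⟨hi, hhi⟩ : ∃ hi, ⌈t / h n⌉₊ = hi + 1 :=
    ⟨⌈t / h n⌉₊ - 1, by have := Nat.ceil_pos.2 (div_pos ht hh); omega⟩
  rw [hhi, Nat.add_sub_cancel]
  have l1 : lo * h n ≤ s := by
    rw [← le_div_iff₀ hh]; exact Nat.floor_le (by positivity)
  have l2 : s ≤ lo * h n + h n := by
    have := Nat.lt_floor_add_one (s / h n)
    rw [div_lt_iff₀ hh] at this
    linarith
  have r1 : hi * h n ≤ t := by
    have : hi < ⌈t / h n⌉₊ := by omega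
    rw [Nat.lt_ceil, lt_div_iff₀ hh] at this
    exact this.le
  have r2 : t ≤ hi * h n + h n := by
    have := Nat.le_ceil (t / h n)
    rw [hhi, div_le_iff₀ hh] at this
    push_cast at this; linarith
  have hle : lo ≤ hi + 1 := by
    have : (lo : ℝ) * h n < (hi + 1 : ℕ) * h n := by push_cast; linarith
    exact_mod_cast (lt_of_mul_lt_mul_right this hh.le).le
  have htel : ∑ u ∈ Finset.Ico lo (hi + 1), (A n (u * h n + h n) ω - A n (u * h n) ω) =
      A n (hi * h n + h n) ω - A n (lo * h n) ω := by
    have := Finset.sum_Ico_sub (fun u : ℕ => A n (u * h n) ω) hle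
    have e : ∀ u : ℕ, (u : ℝ) * h n + h n = ((u + 1 : ℕ) : ℝ) * h n := fun u => by
      push_cast; ring
    simp_rw [e]
    exact this
  rw [htel, cast_unitCount hh.le, cast_unitCount hh.le]
  have hlo0 : (0 : ℝ) ≤ lo * h n := by positivity
  have hhi0 : (0 : ℝ) ≤ hi * h n := by positivity
  have a1 := hA.mono hn ω hlo0 l1
  have a2 := hA.mono hn ω hs l2
  have a3 := hA.mono hn ω hhi0 r1
  have a4 := hA.mono hn ω ht.le r2
  have b1 := hA.sub_le hn ω hlo0 (l1.trans l2)
  have b2 := hA.sub_le hn ω hhi0 (r1.trans r2)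
  rw [abs_le]
  constructor <;> linarith

variable {P : Measure Ω} [IsProbabilityMeasure P]

/-- On the good event, the deviation of an increment from its mean is the deviation of a sum
of bounded local variables, up to a small error. -/
lemma abs_increment_sub_integral_le (hn : 1 ≤ n) (hh : 0 < h n) (hb : 1 ≤ b) {C₁ C₂ : ℝ}
    (hC₁ : ∀ u < n, Integrable (fun ω => (X.unitCount n l u ω : ℝ) ^ 1) P ∧
      ∫ ω, (X.unitCount n l u ω : ℝ) ^ 1 ∂P ≤ C₁)
    (hC₂ : ∀ u < n, Integrable (fun ω => (X.unitCount n l u ω : ℝ) ^ 2) P ∧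
      ∫ ω, (X.unitCount n l u ω : ℝ) ^ 2 ∂P ≤ C₂)
    {Z : ℕ → Ω → ℝ} (hZm : ∀ u < n, Measurable (Z u)) (hZ0 : ∀ u < n, ∀ ω, 0 ≤ Z u ω)
    (hZb : ∀ u < n, ∀ ω, Z u ω ≤ b)
    (hZ : ∀ u < n, ∀ ω ∈ X.goodEvent n l b, A n (u * h n + h n) ω - A n (u * h n) ω = Z u ω)
    {s t : ℝ} (hs : 0 ≤ s) (hst : s < t) (ht : t ≤ n * h n) {ω : Ω} (hω : ω ∈ X.goodEvent n l b) :
    |A n t ω - A n s ω - ∫ ω', (A n t ω' - A n s ω') ∂P| ≤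
      |∑ u ∈ Finset.Ico ⌊s / h n⌋₊ ⌈t / h n⌉₊, (Z u ω - ∫ ω', Z u ω' ∂P)| +
        (2 * b + 2 * C₁ + ((⌈t / h n⌉₊ - ⌊s / h n⌋₊ : ℕ) : ℝ) *
          (2 * b * P.real (X.goodEvent n l b)ᶜ + C₂ / b)) := by
  set lo := ⌊s / h n⌋₊ with hlo
  set hi := ⌈t / h n⌉₊ with hhi
  have hb0 : (0 : ℝ) < b := by exact_mod_cast hb
  have hhin : hi ≤ n := by
    rw [hhi, Nat.ceil_le, div_le_iff₀ hh]; exact ht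
  have hhi1 : 1 ≤ hi := Nat.ceil_pos.2 (div_pos (hs.trans_lt hst) hh)
  have hlon : lo < n := by
    rw [hlo, Nat.floor_lt (by positivity), div_lt_iff₀ hh]; linarith
  have hun : ∀ u ∈ Finset.Ico lo hi, u < n := fun u hu =>
    (Finset.mem_Ico.1 hu).2.trans_le hhin
  simp only [pow_one] at hC₁
  set bad : Ω → ℝ := (X.goodEvent n l b)ᶜ.indicator fun _ => 2 * (b : ℝ) with hbad
  have hbadm := (X.measurableSet_goodEvent n l b).compl
  have hbadi : Integrable bad P := (integrable_const _).indicator hbadm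
  have hbadE : ∫ ω, bad ω ∂P = 2 * b * P.real (X.goodEvent n l b)ᶜ := by
    rw [hbad, integral_indicator hbadm]; simp [mul_comm]
  have hstep : ∀ u < n, ∀ ω, |A n (u * h n + h n) ω - A n (u * h n) ω - Z u ω| ≤
      bad ω + (X.unitCount n l u ω : ℝ) ^ 2 / b := by
    intro u hu ω
    by_cases hg : ω ∈ X.goodEvent n l b
    · rw [hZ u hu ω hg, sub_self, abs_zero, hbad, Set.indicator_of_notMem (by simpa using hg)]
      positivity
    · rw [hbad, Set.indicator_of_mem hg]
      have h1 := hA.step_nonneg hn hh u ω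
      have h2 := hA.step_le hn hh u ω
      have h3 := hZ0 u hu ω
      have h4 := hZb u hu ω
      set D := (X.unitCount n l u ω : ℝ)
      -- the second moment makes up for the lack of a bound off the good event
      have h5 : D ≤ b + D ^ 2 / b := by
        rw [← sub_nonneg]
        have : (b : ℝ) + D ^ 2 / b - D = ((b - D / 2) ^ 2 + 3 / 4 * D ^ 2) / b := by
          field_simp; ring
        rw [this]; positivity
      rw [abs_le]; constructor <;> linarith
  set W : Ω → ℝ := fun ω => A n t ω - A n s ω - ∑ u ∈ Finset.Ico lo hi, Z u ω with hW
  set bound : Ω → ℝ := fun ω => ((X.unitCount n l lo ω : ℝ) + X.unitCount n l (hi - 1) ω) +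
    ∑ u ∈ Finset.Ico lo hi, (bad ω + (X.unitCount n l u ω : ℝ) ^ 2 / b) with hbound
  have hWb : ∀ ω, ‖W ω‖ ≤ bound ω := by
    intro ω
    have h1 := hA.abs_increment_sub_sum_le hn hh hs hst ω
    have h2 : |∑ u ∈ Finset.Ico lo hi, (A n (u * h n + h n) ω - A n (u * h n) ω - Z u ω)| ≤
        ∑ u ∈ Finset.Ico lo hi, (bad ω + (X.unitCount n l u ω : ℝ) ^ 2 / b) :=
      (Finset.abs_sum_le_sum_abs _ _).trans (Finset.sum_le_sum fun u hu => hstep u (hun u hu) ω)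
    rw [Finset.sum_sub_distrib] at h2
    have h3 := (abs_add_le _ _).trans (add_le_add h1 h2)
    rw [Real.norm_eq_abs]
    refine le_trans (le_of_eq ?_) h3
    congr 1
    simp only [hW]; ring
  have hterm : ∀ u ∈ Finset.Ico lo hi,
      Integrable (fun ω => bad ω + (X.unitCount n l u ω : ℝ) ^ 2 / b) P := fun u hu =>
    hbadi.add ((hC₂ u (hun u hu)).1.div_const _)
  have hedge : Integrable (fun ω => (X.unitCount n l lo ω : ℝ) + X.unitCount n l (hi - 1) ω) P :=
    (hC₁ lo hlon).1.add (hC₁ (hi - 1) (by omega)).1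
  have hboundi : Integrable bound P := hedge.add (integrable_finsetSum _ hterm)
  have hboundE : ∫ ω, bound ω ∂P ≤ 2 * C₁ + ((hi - lo : ℕ) : ℝ) *
      (2 * b * P.real (X.goodEvent n l b)ᶜ + C₂ / b) := by
    have e1 : ∫ ω, bound ω ∂P = (∫ ω, (X.unitCount n l lo ω : ℝ) ∂P +
        ∫ ω, (X.unitCount n l (hi - 1) ω : ℝ) ∂P) +
        ∑ u ∈ Finset.Ico lo hi, (∫ ω, bad ω ∂P + (∫ ω, (X.unitCount n l u ω : ℝ) ^ 2 ∂P) / b) := by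
      rw [← integral_add (hC₁ lo hlon).1 (hC₁ (hi - 1) (by omega)).1, hbound]
      rw [integral_add hedge (integrable_finsetSum _ hterm), integral_finsetSum _ hterm]
      congr 1
      refine Finset.sum_congr rfl fun u hu => ?_
      rw [integral_add hbadi ((hC₂ u (hun u hu)).1.div_const _), integral_div]
    rw [e1, hbadE]
    have h1 := (hC₁ lo hlon).2
    have h2 := (hC₁ (hi - 1) (by omega)).2
    have h3 : ∑ u ∈ Finset.Ico lo hi, (2 * b * P.real (X.goodEvent n l b)ᶜ +
        (∫ ω, (X.unitCount n l u ω : ℝ) ^ 2 ∂P) / b) ≤ ((hi - lo : ℕ) : ℝ) *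
        (2 * b * P.real (X.goodEvent n l b)ᶜ + C₂ / b) := by
      refine (Finset.sum_le_card_nsmul _ _ (2 * b * P.real (X.goodEvent n l b)ᶜ + C₂ / b)
        fun u hu => ?_).trans_eq ?_
      · have := (hC₂ u (hun u hu)).2
        gcongr
      · rw [nsmul_eq_mul, Nat.card_Ico]
    linarith
  have hZi : ∀ u ∈ Finset.Ico lo hi, Integrable (Z u) P := fun u hu =>
    Integrable.of_bound (hZm u (hun u hu)).aestronglyMeasurable (b : ℝ) (ae_of_all _ fun ω => by
      rw [Real.norm_eq_abs, abs_of_nonneg (hZ0 u (hun u hu) ω)]; exact hZb u (hun u hu) ω)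
  have hZsi : Integrable (fun ω => ∑ u ∈ Finset.Ico lo hi, Z u ω) P := integrable_finsetSum _ hZi
  have hWm : Measurable W :=
    ((hA.measurable n t).sub (hA.measurable n s)).sub
      (Finset.measurable_sum _ fun u hu => hZm u (hun u hu))
  have hWi : Integrable W P := hboundi.mono' hWm.aestronglyMeasurable (ae_of_all _ hWb)
  have hWE : |∫ ω, W ω ∂P| ≤ ∫ ω, bound ω ∂P :=
    norm_integral_le_of_norm_le hboundi (ae_of_all _ hWb)
  have hHE : ∫ ω', (A n t ω' - A n s ω') ∂P =
      ∫ ω, W ω ∂P + ∑ u ∈ Finset.Ico lo hi, ∫ ω', Z u ω' ∂P := by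
    rw [← integral_finsetSum _ hZi, ← integral_add hWi hZsi]
    refine integral_congr_ae (ae_of_all _ fun ω => ?_)
    simp only [hW]; ring
  have hedgeb : |A n t ω - A n s ω - ∑ u ∈ Finset.Ico lo hi, Z u ω| ≤ 2 * b := by
    have h1 := hA.abs_increment_sub_sum_le hn hh hs hst ω
    rw [Finset.sum_congr rfl fun u hu => hZ u (hun u hu) ω hω] at h1
    have h2 : (X.unitCount n l lo ω : ℝ) ≤ b := by exact_mod_cast hω.2 lo hlon
    have h3 : (X.unitCount n l (hi - 1) ω : ℝ) ≤ b := by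
      exact_mod_cast hω.2 (hi - 1) (by omega)
    linarith
  rw [hHE, Finset.sum_sub_distrib]
  set S := ∑ u ∈ Finset.Ico lo hi, Z u ω
  set T := ∑ u ∈ Finset.Ico lo hi, ∫ ω', Z u ω' ∂P
  calc |A n t ω - A n s ω - (∫ ω, W ω ∂P + T)|
      = |(S - T) + ((A n t ω - A n s ω - S) - ∫ ω, W ω ∂P)| := by congr 1; ring
    _ ≤ |S - T| + |(A n t ω - A n s ω - S) - ∫ ω, W ω ∂P| := abs_add_le _ _
    _ ≤ |S - T| + (|A n t ω - A n s ω - S| + |∫ ω, W ω ∂P|) := by gcongr; exact abs_sub _ _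
    _ ≤ _ := by linarith

end IsLocalCumulative

end ObservationScheme

/-! ### Uniform law of large numbers over the cells -/

section Partition

variable {s : ℕ → ℝ}

lemma IsAdmissiblePartition.strictMono (hs : IsAdmissiblePartition s) : StrictMono s := by
  obtain ⟨δ, hδ, h⟩ := hs.le_mesh
  exact strictMono_nat_of_lt_succ fun k => by linarith [h k]

lemma IsAdmissiblePartition.exists_mul_le (hs : IsAdmissiblePartition s) :
    ∃ δ : ℝ, 0 < δ ∧ ∀ k : ℕ, δ * k ≤ s k := by
  obtain ⟨δ, hδ, h⟩ := hs.le_mesh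
  refine ⟨δ, hδ, fun k => ?_⟩
  induction k with
  | zero => simp [hs.zero]
  | succ k ih => push_cast; linarith [h k]

lemma IsAdmissiblePartition.le_lastIndex (hs : IsAdmissiblePartition s) {T : ℝ} {k : ℕ}
    (hk : s k ≤ T) : k ≤ lastIndex s T := by
  obtain ⟨δ, hδ, h⟩ := hs.exists_mul_le
  refine le_csSup ⟨⌈T / δ⌉₊, fun j hj => ?_⟩ hk
  have h1 : (j : ℝ) ≤ T / δ := by
    rw [le_div_iff₀ hδ, mul_comm]; exact (h j).trans hj
  exact_mod_cast h1.trans (Nat.le_ceil _)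

lemma IsAdmissiblePartition.apply_lastIndex_le (hs : IsAdmissiblePartition s) {T : ℝ} (hT : 0 ≤ T) :
    s (lastIndex s T) ≤ T := by
  obtain ⟨δ, hδ, h⟩ := hs.exists_mul_le
  refine Nat.sSup_mem (s := {k | s k ≤ T}) ⟨0, ?_⟩ ⟨⌈T / δ⌉₊, fun j hj => ?_⟩
  · simpa [hs.zero] using hT
  · have h1 : (j : ℝ) ≤ T / δ := by
      rw [le_div_iff₀ hδ, mul_comm]; exact (h j).trans hj
    exact_mod_cast h1.trans (Nat.le_ceil _)

lemma le_maxAbs {q : ℕ} {x : ℕ → ℝ} {k : ℕ} (hk : k ∈ Finset.Icc 1 q) : |x k| ≤ maxAbs q x := by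
  have := Finset.le_sup (f := fun k => ‖x k‖₊) hk
  exact_mod_cast this

lemma maxAbs_le {q : ℕ} {x : ℕ → ℝ} {c : ℝ} (hc : 0 ≤ c) (h : ∀ k ∈ Finset.Icc 1 q, |x k| ≤ c) :
    maxAbs q x ≤ c := by
  lift c to ℝ≥0 using hc
  refine NNReal.coe_le_coe.2 (Finset.sup_le fun k hk => ?_)
  exact_mod_cast h k hk

lemma maxAbs_nonneg (q : ℕ) (x : ℕ → ℝ) : 0 ≤ maxAbs q x := NNReal.coe_nonneg _

lemma exists_le_abs_of_lt_maxAbs {q : ℕ} {x : ℕ → ℝ} {c : ℝ} (hc : 0 ≤ c) (h : c < maxAbs q x) :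
    ∃ k ∈ Finset.Icc 1 q, c < |x k| := by
  by_contra hcon
  push Not at hcon
  exact absurd (maxAbs_le hc hcon) (not_le.2 h)

end Partition

section Scale

/-- A scale `b n`, comparable to `(1 / h n)^(1/8)`, of which `n` is at most a power. -/
lemma exists_scale {h : ℕ → ℝ} (h_pos : ∀ n, 1 ≤ n → 0 < h n)
    (h_decay : ∃ κ : ℝ, 0 < κ ∧ Tendsto (fun n : ℕ => (n : ℝ) * h n ^ κ) atTop (𝓝 0)) :
    Tendsto h atTop (𝓝 0) ∧ ∃ (b : ℕ → ℕ) (K : ℕ) (C : ℝ), Tendsto b atTop atTop ∧ 0 ≤ C ∧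
      ∀ᶠ n in atTop, (b n : ℝ) ^ 8 * h n ≤ 1 ∧ 1 ≤ 256 * (b n : ℝ) ^ 8 * h n ∧
        (n : ℝ) ≤ C * (b n : ℝ) ^ K := by
  obtain ⟨κ, hκ, hlim⟩ := h_decay
  have hh0 : Tendsto h atTop (𝓝 0) := by
    have h1 : Tendsto (fun n : ℕ => h n ^ κ) atTop (𝓝 0) := by
      refine tendsto_of_tendsto_of_tendsto_of_le_of_le' tendsto_const_nhds hlim ?_ ?_
      · filter_upwards [eventually_ge_atTop 1] with n hn
        exact Real.rpow_nonneg (h_pos n hn).le _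
      · filter_upwards [eventually_ge_atTop 1] with n hn
        have h2 := Real.rpow_nonneg (h_pos n hn).le κ
        have h3 : (1 : ℝ) ≤ n := by exact_mod_cast hn
        nlinarith
    have h2 : Tendsto (fun n : ℕ => (h n ^ κ) ^ (1 / κ)) atTop (𝓝 (0 ^ (1 / κ))) :=
      h1.rpow_const (Or.inr (by positivity))
    rw [Real.zero_rpow (by positivity)] at h2
    refine h2.congr' ?_
    filter_upwards [eventually_ge_atTop 1] with n hn
    rw [← Real.rpow_mul (h_pos n hn).le, mul_one_div_cancel hκ.ne', Real.rpow_one]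
  refine ⟨hh0, fun n => ⌊(1 / h n) ^ (1 / 8 : ℝ)⌋₊, 8 * ⌈κ⌉₊, 256 ^ ⌈κ⌉₊, ?_, by positivity, ?_⟩
  · refine tendsto_nat_floor_atTop.comp ((tendsto_rpow_atTop (by norm_num)).comp ?_)
    have : Tendsto h atTop (𝓝[>] 0) := by
      refine tendsto_nhdsWithin_iff.2 ⟨hh0, ?_⟩
      filter_upwards [eventually_ge_atTop 1] with n hn using h_pos n hn
    exact (tendsto_inv_nhdsGT_zero.comp this).congr fun n => (one_div _).symm
  · filter_upwards [eventually_ge_atTop 1,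
      hh0.eventually (ge_mem_nhds (show (0 : ℝ) < 1 by norm_num)),
      hlim.eventually (ge_mem_nhds (show (0 : ℝ) < 1 by norm_num))] with n hn hh1 hn1
    have hh := h_pos n hn
    set x := (1 / h n) ^ (1 / 8 : ℝ) with hx
    have hx8 : x ^ 8 = 1 / h n := by
      rw [hx, ← Real.rpow_natCast, ← Real.rpow_mul (by positivity)]
      norm_num
    have hx1 : 1 ≤ x := Real.one_le_rpow (by rw [le_div_iff₀ hh]; linarith) (by norm_num)
    have hfl : (⌊x⌋₊ : ℝ) ≤ x := Nat.floor_le (by linarith)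
    have hfl1 : (1 : ℝ) ≤ ⌊x⌋₊ := by exact_mod_cast Nat.one_le_floor_iff x |>.2 hx1
    have hfl2 : x ≤ 2 * ⌊x⌋₊ := by linarith [Nat.lt_floor_add_one x]
    have e2 : 1 / h n ≤ 256 * (⌊x⌋₊ : ℝ) ^ 8 := by
      rw [← hx8]
      calc x ^ 8 ≤ (2 * (⌊x⌋₊ : ℝ)) ^ 8 := by gcongr
        _ = 256 * (⌊x⌋₊ : ℝ) ^ 8 := by rw [mul_pow]; norm_num
    refine ⟨?_, ?_, ?_⟩
    · have : (⌊x⌋₊ : ℝ) ^ 8 ≤ 1 / h n := by rw [← hx8]; gcongr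
      rwa [le_div_iff₀ hh] at this
    · rwa [div_le_iff₀ hh] at e2
    · have h3 : (n : ℝ) * h n ^ ⌈κ⌉₊ ≤ 1 := by
        refine le_trans ?_ hn1
        gcongr
        rw [← Real.rpow_natCast]
        exact Real.rpow_le_rpow_of_exponent_ge hh hh1 (Nat.le_ceil κ)
      calc (n : ℝ) ≤ (1 / h n) ^ ⌈κ⌉₊ := by
            rw [one_div_pow, le_div_iff₀ (by positivity)]; exact h3
        _ ≤ (256 * (⌊x⌋₊ : ℝ) ^ 8) ^ ⌈κ⌉₊ := by gcongr
        _ = 256 ^ ⌈κ⌉₊ * (⌊x⌋₊ : ℝ) ^ (8 * ⌈κ⌉₊) := by rw [mul_pow, ← pow_mul]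

end Scale

namespace ObservationScheme

variable {Ω : Type*} [m₀ : MeasurableSpace Ω] {h : ℕ → ℝ} {X : ObservationScheme Ω h}
  {P : Measure Ω} [IsProbabilityMeasure P]

/-- The powers of `b` in the union bound over the cells: the sums in the cells deviate with
probability at most a constant times `1 / b`. -/
lemma union_bound_le {b K q c n N m : ℕ} {ε δ H C Cα α : ℝ} (hb : 1 ≤ b) (hε : 0 < ε) (hδ : 0 < δ)
    (hH : 0 < H) (hC : 0 ≤ C) (hCα : 0 ≤ Cα) (hα0 : 0 ≤ α) (hα : α ≤ Cα / (b : ℝ) ^ (8 * q))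
    (hbH : (b : ℝ) ^ 8 * H ≤ 1) (hN : (N : ℝ) ≤ 768 * (b : ℝ) ^ 8)
    (hm : (m : ℝ) ≤ c * b) (hn : (n : ℝ) ≤ C * (b : ℝ) ^ K) (hq : K + 2 ≤ 4 * q) :
    n / δ * (m * (m / (ε / H)) ^ (2 * q) * ((b : ℝ) ^ (2 * q) *
      ((N : ℝ) ^ q * (q : ℝ) ^ (2 * q) + (N : ℝ) ^ (2 * q) * (8 * α)))) ≤
      C / δ * (c * (c / ε) ^ (2 * q) * (768 ^ q * (q : ℝ) ^ (2 * q) + 768 ^ (2 * q) * (8 * Cα))) /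
        b := by
  have hb1 : (1 : ℝ) ≤ b := by exact_mod_cast hb
  have hb0 : (0 : ℝ) < b := by linarith
  have h1 : (m : ℝ) / (ε / H) ≤ (c / ε) * (b / (b : ℝ) ^ 8) := by
    have : H ≤ 1 / (b : ℝ) ^ 8 := by
      rw [le_div_iff₀ (by positivity), mul_comm]; exact hbH
    calc (m : ℝ) / (ε / H) = m * H / ε := by field_simp
      _ ≤ (c * b) * (1 / (b : ℝ) ^ 8) / ε := by gcongr
      _ = _ := by ring
  have h2 : (N : ℝ) ^ q * (q : ℝ) ^ (2 * q) + (N : ℝ) ^ (2 * q) * (8 * α) ≤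
      (768 ^ q * (q : ℝ) ^ (2 * q) + 768 ^ (2 * q) * (8 * Cα)) * (b : ℝ) ^ (8 * q) := by
    calc (N : ℝ) ^ q * (q : ℝ) ^ (2 * q) + (N : ℝ) ^ (2 * q) * (8 * α)
        ≤ (768 * (b : ℝ) ^ 8) ^ q * (q : ℝ) ^ (2 * q) +
          (768 * (b : ℝ) ^ 8) ^ (2 * q) * (8 * (Cα / (b : ℝ) ^ (8 * q))) := by gcongr
      _ = _ := by
        have e : (b : ℝ) ^ (8 * (2 * q)) = (b : ℝ) ^ (8 * q) * (b : ℝ) ^ (8 * q) := by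
          rw [← pow_add]; congr 1; ring
        rw [mul_pow, mul_pow, ← pow_mul, ← pow_mul, e]
        field_simp
  set D := 768 ^ q * (q : ℝ) ^ (2 * q) + 768 ^ (2 * q) * (8 * Cα) with hD
  have hD0 : 0 ≤ D := by positivity
  calc _ ≤ (C * (b : ℝ) ^ K) / δ * ((c * b) * ((c / ε) * (b / (b : ℝ) ^ 8)) ^ (2 * q) *
        ((b : ℝ) ^ (2 * q) * (D * (b : ℝ) ^ (8 * q)))) := by gcongr
    _ = C / δ * (c * (c / ε) ^ (2 * q) * D) *
        ((b : ℝ) ^ (K + 1 + 2 * q + 2 * q + 8 * q) / (b : ℝ) ^ (16 * q)) := by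
        have e : ((b : ℝ) ^ 8) ^ (2 * q) = (b : ℝ) ^ (16 * q) := by
          rw [← pow_mul]; congr 1; ring
        rw [mul_pow, div_pow (b : ℝ), e]
        simp only [pow_add, pow_one]
        ring
    _ ≤ C / δ * (c * (c / ε) ^ (2 * q) * D) * (1 / b) := by
        gcongr ?_ * ?_
        rw [div_le_div_iff₀ (by positivity) hb0, one_mul, ← pow_succ]
        exact pow_le_pow_right₀ hb1 (by omega)
    _ = _ := by ring

/-- Uniform law of large numbers over the cells of a partition: on the good event the deviations are
those of sums of bounded local variables, and these are controlled by moments of high order and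
a union bound over the cells. -/
theorem IsLocalCumulative.tendstoInMeasure_maxAbs {l : Fin 2} {c : ℕ} {A : ℕ → ℝ → Ω → ℝ}
    (hA : X.IsLocalCumulative l c A) (h_pos : ∀ n, 1 ≤ n → 0 < h n)
    (h_decay : ∃ κ : ℝ, 0 < κ ∧ Tendsto (fun n : ℕ => (n : ℝ) * h n ^ κ) atTop (𝓝 0))
    (hB1 : ∀ q : ℝ, 0 < q → X.CondB1 P q) (hB2 : ∀ q : ℝ, 0 < q → X.CondB2 P q)
    (hmix : ∀ q : ℝ, 0 < q → X.CondMixing P q) {s : ℕ → ℝ} (hs : IsAdmissiblePartition s) :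
    TendstoInMeasure P (fun (n : ℕ) ω => maxAbs (lastIndex s (n * h n)) fun k =>
      h n * (A n (s k) ω - A n (s (k - 1)) ω) -
        h n * ∫ ω', (A n (s k) ω' - A n (s (k - 1)) ω') ∂P) atTop fun _ => 0 := by
  obtain ⟨hh0, b, K, C, hb, hC, hscale⟩ := exists_scale h_pos h_decay
  -- a moment of order `2 q` with `4 q ≥ K + 2` beats the number of cells, of order `b ^ K`
  set q := K + 1 with hqdef
  obtain ⟨C₁, hC₁0, hC₁⟩ := (show X.CondB1 P (1 : ℕ) from hB1 _ (by simp)).exists_integral_le h_pos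
  obtain ⟨C₂, hC₂0, hC₂⟩ := (show X.CondB1 P (2 : ℕ) from hB1 _ (by simp)).exists_integral_le h_pos
  obtain ⟨Cα, hCα0, hCα⟩ := (show X.CondMixing P (8 * q : ℕ) from
    hmix _ (by positivity)).exists_le
  obtain ⟨Cg, hCg0, hCg⟩ := exists_measureReal_goodEvent_compl_le h_pos (K + 2)
    (hB1 _ (by positivity)) (hB2 _ (by positivity))
  obtain ⟨δ, hδ, hsδ⟩ := hs.exists_mul_le
  rw [tendstoInMeasure_iff_measureReal_norm]
  intro ε hε
  have hbR : Tendsto (fun n => (b n : ℝ)) atTop atTop := tendsto_natCast_atTop_atTop.comp hb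
  -- constants of the deterministic error and of the probability bound
  obtain ⟨E, hE⟩ : ∃ E, E = 2 + 2 * C₁ + 3 * (2 * (Cg * C) + C₂) := ⟨_, rfl⟩
  obtain ⟨F, hF⟩ : ∃ F, F =
    C / δ * (((2 * c + 2 : ℕ) : ℝ) * (((2 * c + 2 : ℕ) : ℝ) / (ε / 2)) ^ (2 * q) *
    (768 ^ q * (q : ℝ) ^ (2 * q) + 768 ^ (2 * q) * (8 * Cα))) := ⟨_, rfl⟩
  have hE0 : 0 ≤ E := by rw [hE]; positivity
  have hF0 : 0 ≤ F := by rw [hF]; positivity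
  have hlim : Tendsto (fun n => (Cg * C + F) / (b n : ℝ)) atTop (𝓝 0) :=
    tendsto_const_nhds.div_atTop hbR
  have hEsmall : ∀ᶠ n in atTop, E / (b n : ℝ) < ε / 2 :=
    (tendsto_const_nhds.div_atTop hbR : Tendsto (fun n => E / (b n : ℝ)) atTop (𝓝 0)).eventually
      (gt_mem_nhds (by positivity))
  refine tendsto_of_tendsto_of_tendsto_of_le_of_le' tendsto_const_nhds hlim
    (Eventually.of_forall fun n => measureReal_nonneg) ?_
  filter_upwards [hscale, hb.eventually hCg, hb.eventually (eventually_ge_atTop 1), hEsmall,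
    eventually_ge_atTop 1, hh0.eventually (ge_mem_nhds (show (0 : ℝ) < 1 by norm_num))]
    with n ⟨hs1, hs2, hs3⟩ hg hb1 hEn hn hhle
  have hh := h_pos n hn
  set B := b n with hB
  have hB1' : (1 : ℝ) ≤ B := by exact_mod_cast hb1
  have hB0 : (0 : ℝ) < B := by linarith
  have hbad : P.real (X.goodEvent n l B)ᶜ ≤ Cg * C / B ^ 2 := by
    calc P.real (X.goodEvent n l B)ᶜ ≤ Cg * n / (B : ℝ) ^ (K + 2) := hg n hn l
      _ ≤ Cg * (C * (B : ℝ) ^ K) / (B : ℝ) ^ (K + 2) := by gcongr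
      _ = Cg * C / B ^ 2 := by rw [pow_add]; field_simp
  obtain ⟨Z, hZ⟩ := hA.exists_truncation hn hh hb1
  set qn := lastIndex s (n * h n) with hqn
  set lo : ℕ → ℕ := fun k => ⌊s (k - 1) / h n⌋₊ with hlo
  set hi : ℕ → ℕ := fun k => ⌈s k / h n⌉₊ with hhi
  have hcell : ∀ k ∈ Finset.Icc 1 qn, 0 ≤ s (k - 1) ∧ s (k - 1) < s k ∧ s k ≤ n * h n := by
    intro k hk
    obtain ⟨hk1, hk2⟩ := Finset.mem_Icc.1 hk
    refine ⟨?_, hs.strictMono (by omega), ?_⟩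
    · rw [← hs.zero]; exact hs.strictMono.monotone (Nat.zero_le _)
    · exact (hs.strictMono.monotone hk2).trans (hs.apply_lastIndex_le (by positivity))
  have hNk : ∀ k ∈ Finset.Icc 1 qn, ((hi k - lo k : ℕ) : ℝ) * h n ≤ 3 := by
    intro k hk
    obtain ⟨c1, c2, c3⟩ := hcell k hk
    obtain ⟨hk1, hk2⟩ := Finset.mem_Icc.1 hk
    have hmesh := hs.mesh_le (k - 1)
    rw [Nat.sub_add_cancel hk1] at hmesh
    have u1 : (hi k : ℝ) < s k / h n + 1 := Nat.ceil_lt_add_one (div_nonneg (by linarith) hh.le)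
    have u2 : s (k - 1) / h n < (lo k : ℝ) + 1 := Nat.lt_floor_add_one _
    have u3 : lo k ≤ hi k := by
      refine (Nat.floor_le_ceil _).trans (Nat.ceil_le_ceil ?_)
      gcongr
    rw [Nat.cast_sub u3]
    have u4 : s k / h n * h n = s k := by field_simp
    have u5 : s (k - 1) / h n * h n = s (k - 1) := by field_simp
    nlinarith
  set S : ℕ → Ω → ℝ := fun k ω =>
    ∑ u ∈ Finset.Ico (lo k) (hi k), (Z u ω - ∫ ω', Z u ω' ∂P) with hS
  have hsub : {ω | ε ≤ ‖(maxAbs qn fun k => h n * (A n (s k) ω - A n (s (k - 1)) ω) -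
        h n * ∫ ω', (A n (s k) ω' - A n (s (k - 1)) ω') ∂P) - 0‖} ⊆
      (X.goodEvent n l B)ᶜ ∪ ⋃ k ∈ Finset.Icc 1 qn, {ω | ε / 2 / h n ≤ |S k ω|} := by
    intro ω hω
    by_cases hgood : ω ∈ X.goodEvent n l B
    swap
    · exact Or.inl hgood
    right
    simp only [sub_zero, Set.mem_ofPred_eq, Real.norm_eq_abs, abs_of_nonneg (maxAbs_nonneg _ _)]
      at hω
    by_contra hcon
    simp only [Set.mem_iUnion, Set.mem_ofPred_eq, not_exists, not_le] at hcon
    have hlt : E / B + ε / 2 < ε := by linarith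
    obtain ⟨k, hk, hklt⟩ := exists_le_abs_of_lt_maxAbs (by positivity) (hlt.trans_le hω)
    obtain ⟨c1, c2, c3⟩ := hcell k hk
    have hdev := hA.abs_increment_sub_integral_le hn hh hb1 (hC₁ n hn l) (hC₂ n hn l)
      (fun u hu => ((hZ u hu).1).mono (incrementSigma_le _ _ _) le_rfl) (fun u hu => (hZ u hu).2.1)
      (fun u hu => (hZ u hu).2.2.1) (fun u hu => (hZ u hu).2.2.2) c1 c2 c3 hgood
    rw [← mul_sub, abs_mul, abs_of_pos hh] at hklt
    have hSk := hcon k hk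
    rw [lt_div_iff₀ hh] at hSk
    -- the boundary steps, the means and the truncation contribute at most `E / B`
    have hB8 : (B : ℝ) * h n ≤ 1 / B := by
      rw [le_div_iff₀ hB0]
      calc (B : ℝ) * h n * B = (B : ℝ) ^ 2 * h n := by ring
        _ ≤ (B : ℝ) ^ 8 * h n := by
            gcongr ?_ * _
            exact pow_le_pow_right₀ hB1' (by norm_num)
        _ ≤ 1 := hs1
    have herr : h n * (2 * B + 2 * C₁ + ((hi k - lo k : ℕ) : ℝ) *
        (2 * B * P.real (X.goodEvent n l B)ᶜ + C₂ / B)) ≤ E / B := by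
      have t1 : h n ≤ 1 / B := le_trans (by nlinarith) hB8
      have t2 : 2 * B * P.real (X.goodEvent n l B)ᶜ + C₂ / B ≤ (2 * (Cg * C) + C₂) / B := by
        calc 2 * B * P.real (X.goodEvent n l B)ᶜ + C₂ / B
            ≤ 2 * B * (Cg * C / B ^ 2) + C₂ / B := by gcongr
          _ = _ := by field_simp
      calc h n * (2 * B + 2 * C₁ + ((hi k - lo k : ℕ) : ℝ) *
            (2 * B * P.real (X.goodEvent n l B)ᶜ + C₂ / B))
          = 2 * (B * h n) + 2 * C₁ * h n + (((hi k - lo k : ℕ) : ℝ) * h n) *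
            (2 * B * P.real (X.goodEvent n l B)ᶜ + C₂ / B) := by ring
        _ ≤ 2 * (1 / B) + 2 * C₁ * (1 / B) + 3 * ((2 * (Cg * C) + C₂) / B) := by
            gcongr
            exact hNk k hk
        _ = E / B := by rw [hE]; ring
    have hfin : h n * |A n (s k) ω - A n (s (k - 1)) ω -
        ∫ ω', (A n (s k) ω' - A n (s (k - 1)) ω') ∂P| ≤ |S k ω| * h n + E / B := by
      refine (mul_le_mul_of_nonneg_left hdev hh.le).trans ?_
      rw [mul_add, mul_comm (h n) |_|]
      exact add_le_add_right herr _
    linarith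
  have hqle : (qn : ℝ) ≤ n / δ := by
    rw [le_div_iff₀ hδ, mul_comm]
    have h1 := (hsδ qn).trans (hs.apply_lastIndex_le (show 0 ≤ n * h n by positivity))
    have h2 : (n : ℝ) * h n ≤ n * 1 := by gcongr
    linarith
  obtain ⟨hfin, hαle⟩ := hCα n hn B
  have hprob : ∀ k ∈ Finset.Icc 1 qn, P.real {ω | ε / 2 / h n ≤ |S k ω|} ≤ F / B / (n / δ) := by
    intro k hk
    obtain ⟨c1, c2, c3⟩ := hcell k hk
    have hhin : hi k ≤ n := by
      simp only [hhi]; rw [Nat.ceil_le, div_le_iff₀ hh]; exact c3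
    have h1 := measureReal_le_abs_sum_le (lo := lo k) (c := ε / 2 / h n) q hh hfin
      (fun u hu => (hZ u hu).1) (fun u hu => (hZ u hu).2.1)
      (fun u hu => (hZ u hu).2.2.1) hhin (by positivity)
    refine h1.trans ?_
    have hn0 : (0 : ℝ) < n := by exact_mod_cast hn
    rw [le_div_iff₀ (by positivity), mul_comm, hF]
    refine union_bound_le hb1 (by positivity) hδ hh hC hCα0 ENNReal.toReal_nonneg ?_ hs1 ?_ ?_ hs3
      (by omega)
    · refine hαle.trans ?_
      gcongr
      linarith
    · have h3 := hNk k hk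
      have h4 : ((hi k - lo k : ℕ) : ℝ) * h n ≤ (768 * (B : ℝ) ^ 8) * h n := by linarith
      exact le_of_mul_le_mul_right h4 hh
    · have : 2 * (c * B) + 1 + B ≤ (2 * c + 2) * B := by nlinarith
      exact_mod_cast this
  have hn0 : (0 : ℝ) < n := by exact_mod_cast hn
  calc _ ≤ P.real ((X.goodEvent n l B)ᶜ ∪
        ⋃ k ∈ Finset.Icc 1 qn, {ω | ε / 2 / h n ≤ |S k ω|}) :=
        measureReal_mono hsub (measure_ne_top _ _)
    _ ≤ P.real (X.goodEvent n l B)ᶜ + ∑ k ∈ Finset.Icc 1 qn, F / B / (n / δ) := by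
        refine (measureReal_union_le _ _).trans (add_le_add le_rfl ?_)
        exact (measureReal_biUnion_finset_le _ _).trans (Finset.sum_le_sum hprob)
    _ ≤ Cg * C / B + F / B := by
        refine add_le_add (hbad.trans ?_) ?_
        · gcongr
          nlinarith
        · rw [Finset.sum_const, Nat.card_Icc, Nat.add_sub_cancel, nsmul_eq_mul]
          calc (qn : ℝ) * (F / B / (n / δ)) ≤ (n / δ) * (F / B / (n / δ)) := by gcongr
            _ = F / B := by field_simp
    _ = (Cg * C + F) / B := by ring

end ObservationScheme

/-! ### Counts and traces as local cumulative quantities -/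

section PathTrace

lemma pathTrace_add (x y : ℕ → ℝ) (p : ℕ) {a b c : ℝ} (hab : a ≤ b) (hbc : b ≤ c) :
    pathTrace x y p a b + pathTrace x y p b c = pathTrace x y p a c := by
  unfold pathTrace
  rw [← ENNReal.tsum_add]
  refine tsum_congr fun i => ?_
  rw [← Set.Ioc_union_Ioc_eq_Ioc hab hbc, Set.indicator_union_of_disjoint
    (Set.Ioc_disjoint_Ioc_of_le le_rfl)]

end PathTrace

namespace ObservationScheme

variable {Ω : Type*} [m₀ : MeasurableSpace Ω] {h : ℕ → ℝ} (X : ObservationScheme Ω h)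

section Counts

lemma cellCount_add_counting {s : ℕ → ℝ} {n : ℕ} {l : Fin 2} {k : ℕ} (hs : s (k - 1) ≤ s k)
    (ω : Ω) : X.cellCount n l s k ω + X.counting n l (s (k - 1)) ω = X.counting n l (s k) ω :=
  X.card_filter_Ioc_add_counting hs

/-- The increment of the counting process over one step is itself local, without any margin. -/
lemma isLocalCumulative_counting (h_pos : ∀ n, 1 ≤ n → 0 < h n) (l : Fin 2) :
    X.IsLocalCumulative l 0 fun n t ω => (X.counting n l t ω : ℝ) where
  measurable n t := measurable_from_top.comp (X.measurable_counting n l t)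
  mono _ _ _ ω _ hst := by exact_mod_cast X.counting_mono _ l ω hst
  sub_le _ _ _ _ _ _ := le_rfl
  exists_local {n d u} hn hd hu := by
    have hh := h_pos n hn
    refine ⟨fun ω => (X.unitCount n l u ω : ℝ), ?_, fun ω _ => (cast_unitCount hh.le l u ω).symm⟩
    rw [zero_mul, Nat.sub_zero, add_zero, min_eq_right hu]
    exact measurable_from_top.comp (measurable_increment (X := X) (i := u) (j := u + 1) l le_rfl
      (by linarith) (by push_cast; linarith))

end Counts

section Traces

variable {X} {n : ℕ} {ω : Ω}

lemma pathWeight_extTime_of_le (hn : 1 ≤ n) {p i : ℕ} (hp : 1 ≤ p) (hi : X.numObs n 0 ω ≤ i)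
    (i' : ℕ) : pathWeight (X.extTime n 0 · ω) (X.extTime n 1 · ω) p i' i = 0 := by
  obtain ⟨p, rfl⟩ : ∃ p', p = p' + 1 := ⟨p - 1, by omega⟩
  have : ∀ k, overlapRatio (X.extTime n 0 · ω) (X.extTime n 1 · ω) i k = 0 := fun k =>
    overlapRatio_eq_zero_of_le (by
      simp only [X.extTime_of_ge hn hi, X.extTime_of_ge hn (show X.numObs n 0 ω ≤ i + 1 by omega),
        le_refl])
  simp [pathWeight, this]

lemma pathTrace_extTime_eq_sum (hn : 1 ≤ n) {p : ℕ} (hp : 1 ≤ p) (a b : ℝ) :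
    pathTrace (X.extTime n 0 · ω) (X.extTime n 1 · ω) p a b =
      ∑ i ∈ Finset.range (X.numObs n 0 ω), (Set.Ioc a b).indicator
        (fun _ => pathWeight (X.extTime n 0 · ω) (X.extTime n 1 · ω) p i i)
        (X.time n 0 (i + 1) ω) := by
  unfold pathTrace
  rw [tsum_eq_sum (s := Finset.range (X.numObs n 0 ω))]
  · refine Finset.sum_congr rfl fun i hi => ?_
    simp only [X.extTime_of_le (show i + 1 ≤ _ from Finset.mem_range.1 hi)]
  · intro i hi
    rw [pathWeight_extTime_of_le hn hp (by simpa using hi)]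
    simp

/-- The trace over `(s, t]` is at most the number of observations in `(s, t]`, because the diagonal
entries of `(G Gᵀ)^p` lie in `[0, 1]`. For `p = 0` this would fail: the continued times have
infinitely many degenerate intervals, each of weight `1`. -/
lemma pathTrace_extTime_le (hn : 1 ≤ n) {p : ℕ} (hp : 1 ≤ p) {s t : ℝ} (hst : s ≤ t) :
    pathTrace (X.extTime n 0 · ω) (X.extTime n 1 · ω) p s t ≤
      ((X.counting n 0 t ω - X.counting n 0 s ω : ℕ) : ℝ≥0∞) := by
  rw [pathTrace_extTime_eq_sum hn hp, ← X.card_filter_Ioc_add_counting hst, Nat.add_sub_cancel,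
    Finset.card_filter, Nat.cast_sum]
  have hrange : Finset.Icc 1 (X.numObs n 0 ω) = Finset.Ico (0 + 1) (X.numObs n 0 ω + 1) := by
    ext i; simp [Order.lt_add_one_iff]
  rw [hrange, ← Finset.sum_Ico_add' _ 0, Finset.range_eq_Ico]
  refine Finset.sum_le_sum fun i _ => ?_
  by_cases hmem : X.time n 0 (i + 1) ω ∈ Set.Ioc s t
  · rw [Set.indicator_of_mem hmem, if_pos (Set.mem_Ioc.1 hmem), Nat.cast_one]
    exact pathWeight_self_le_one (fun i => X.extTime_le_succ hn i) (fun i => X.extTime_le_succ hn i)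
      p i
  · rw [Set.indicator_of_notMem hmem]
    exact zero_le

variable (X) in
/-- The cumulative version of `tr (E_(k)^1 (G Gᵀ)^p)`. -/
noncomputable def cumulativeTrace (p n : ℕ) (t : ℝ) (ω : Ω) : ℝ :=
  (pathTrace (X.extTime n 0 · ω) (X.extTime n 1 · ω) p 0 t).toReal

lemma cumulativeTrace_sub (hn : 1 ≤ n) {p : ℕ} (hp : 1 ≤ p) {s t : ℝ} (hs : 0 ≤ s) (hst : s ≤ t) :
    X.cumulativeTrace p n t ω - X.cumulativeTrace p n s ω =
      (pathTrace (X.extTime n 0 · ω) (X.extTime n 1 · ω) p s t).toReal := by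
  have hfin : ∀ {a b : ℝ}, a ≤ b →
      pathTrace (X.extTime n 0 · ω) (X.extTime n 1 · ω) p a b ≠ ⊤ := fun hab =>
    ne_top_of_le_ne_top (ENNReal.natCast_ne_top _) (pathTrace_extTime_le hn hp hab)
  unfold cumulativeTrace
  rw [← pathTrace_add _ _ p hs hst, ENNReal.toReal_add (hfin hs) (hfin hst)]
  ring

variable (X) in
/-- The radius `4 p + 9` leaves room for the paths of length `2 p` through intervals of length
at most `2 d h_n`. -/
lemma isLocalCumulative_cumulativeTrace (h_pos : ∀ n, 1 ≤ n → 0 < h n) {p : ℕ} (hp : 1 ≤ p) :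
    X.IsLocalCumulative 0 (4 * p + 9) (X.cumulativeTrace p) where
  measurable n t := (measurable_pathTrace (X.measurable_extTime n 0) (X.measurable_extTime n 1)
    p 0 t).ennreal_toReal
  mono {n} hn {s t} ω hs hst := by
    rw [← sub_nonneg, cumulativeTrace_sub hn hp hs hst]
    exact ENNReal.toReal_nonneg
  sub_le {n} hn {s t} ω hs hst := by
    rw [cumulativeTrace_sub hn hp hs hst, ← Nat.cast_sub (X.counting_mono n 0 ω hst)]
    have := ENNReal.toReal_mono (ENNReal.natCast_ne_top _)
      (pathTrace_extTime_le (X := X) (ω := ω) hn hp hst)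
    rwa [ENNReal.toReal_natCast] at this
  exists_local {n d u} hn hd hu := by
    have hh := h_pos n hn
    set w := (4 * p + 9) * d with hw
    set a := u - w with ha
    set e := min n (u + 1 + w) with he
    have hae : a ≤ e := by rw [he, le_min_iff]; constructor <;> omega
    have hen : e ≤ n := min_le_left _ _
    refine ⟨fun ω => (pathTrace (X.localTime n 0 a e · ω) (X.localTime n 1 a e · ω) p
      (u * h n) (u * h n + h n)).toReal, ?_, fun ω hω => ?_⟩
    · exact (measurable_pathTrace (measurable_localTime X hn hh hae hen)
        (measurable_localTime X hn hh hae hen) p _ _).ennreal_toReal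
    · rw [cumulativeTrace_sub hn hp (by positivity) (by linarith)]
      have hd' : (1 : ℝ) ≤ d := by exact_mod_cast hd
      have hdh : h n ≤ d * h n := by nlinarith
      have hwr : (w : ℝ) = (4 * p + 9) * d := by rw [hw]; push_cast; ring
      have hm : ∀ l, MeshLE (fun i => X.extTime n l i ω) (2 * d * h n) := fun l =>
        X.meshLE_extTime hn hh hd hω
      have hagree : ∀ l, AgreesBetween (fun i => X.extTime n l i ω)
          (fun i => X.localTime n l a e i ω) (X.counting n l (a * h n) ω)
          (u * h n - (2 * p + 4) * (2 * d * h n))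
          (u * h n + h n + (2 * p + 3) * (2 * d * h n)) := by
        intro l
        refine X.agreesBetween_localTime hn hh (by omega) ?_ ?_
        · rcases Nat.eq_zero_or_pos a with h0 | h0
          · exact Or.inr h0
          · left
            have : (a : ℝ) = u - w := by rw [ha, Nat.cast_sub (by omega)]
            rw [this, hwr]
            nlinarith
        · rcases min_choice n (u + 1 + w) with h0 | h0
          · exact Or.inr (he.trans h0)
          · left
            have : (e : ℝ) = u + 1 + w := by rw [he, h0]; push_cast; ring
            rw [this, hwr]
            nlinarith
      beta_reduce
      rw [pathTrace_eq_of_agreesBetween (hagree 0) (hagree 1) (hm 0) (hm 1)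
        (X.meshLE_localTime a e (hm 0)) (X.meshLE_localTime a e (hm 1)) p (by linarith)
        (by linarith)]

lemma overlapMatrix_apply (i : Fin (X.numObs n 0 ω)) (k : Fin (X.numObs n 1 ω)) :
    X.overlapMatrix n ω i k =
      overlapRatio (X.extTime n 0 · ω) (X.extTime n 1 · ω) i k := by
  have h1 := i.2
  have h2 := k.2
  simp only [overlapMatrix, Matrix.of_apply, overlapRatio, X.extTime_of_le (Nat.succ_le_of_lt h1),
    X.extTime_of_le h1.le, X.extTime_of_le (Nat.succ_le_of_lt h2), X.extTime_of_le h2.le]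

lemma overlapMatrix_gram_pow_nonneg (p : ℕ) (i i' : Fin (X.numObs n 0 ω)) :
    0 ≤ ((X.overlapMatrix n ω * (X.overlapMatrix n ω).transpose) ^ p) i i' := by
  induction p generalizing i' with
  | zero => rw [pow_zero, Matrix.one_apply]; split_ifs <;> norm_num
  | succ p ih =>
    rw [pow_succ, Matrix.mul_apply]
    refine Finset.sum_nonneg fun m _ => mul_nonneg (ih m) ?_
    rw [Matrix.mul_apply]
    refine Finset.sum_nonneg fun k _ => ?_
    rw [Matrix.transpose_apply, overlapMatrix_apply, overlapMatrix_apply]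
    exact mul_nonneg (overlapRatio_nonneg _ _ _ _) (overlapRatio_nonneg _ _ _ _)

/-- The entries of the powers of `G Gᵀ` are sums over paths. -/
lemma ofReal_overlapMatrix_gram_pow (hn : 1 ≤ n) (p : ℕ) (i i' : Fin (X.numObs n 0 ω)) :
    ENNReal.ofReal (((X.overlapMatrix n ω * (X.overlapMatrix n ω).transpose) ^ p) i i') =
      pathWeight (X.extTime n 0 · ω) (X.extTime n 1 · ω) p i i' := by
  induction p generalizing i' with
  | zero =>
    rw [pow_zero, Matrix.one_apply]
    simp only [pathWeight, Fin.val_inj]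
    split_ifs <;> simp
  | succ p ih =>
    have hgram : ∀ m m' : Fin (X.numObs n 0 ω),
        0 ≤ (X.overlapMatrix n ω * (X.overlapMatrix n ω).transpose) m m' := fun m m' => by
      simpa using overlapMatrix_gram_pow_nonneg (X := X) (n := n) (ω := ω) 1 m m'
    rw [pow_succ, Matrix.mul_apply, ENNReal.ofReal_sum_of_nonneg fun m _ =>
      mul_nonneg (overlapMatrix_gram_pow_nonneg p i m) (hgram m i')]
    simp only [pathWeight]
    rw [tsum_eq_sum (s := Finset.range (X.numObs n 0 ω)), Finset.sum_range]
    · refine Finset.sum_congr rfl fun m _ => ?_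
      rw [ENNReal.ofReal_mul (overlapMatrix_gram_pow_nonneg p i m), ih, ENNReal.tsum_mul_left]
      congr 1
      rw [tsum_eq_sum (s := Finset.range (X.numObs n 1 ω)), Finset.sum_range, Matrix.mul_apply,
        ENNReal.ofReal_sum_of_nonneg]
      · refine Finset.sum_congr rfl fun k _ => ?_
        rw [Matrix.transpose_apply, overlapMatrix_apply, overlapMatrix_apply,
          ENNReal.ofReal_mul (overlapRatio_nonneg _ _ _ _)]
      · intro k _
        rw [Matrix.transpose_apply, overlapMatrix_apply, overlapMatrix_apply]
        exact mul_nonneg (overlapRatio_nonneg _ _ _ _) (overlapRatio_nonneg _ _ _ _)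
      · intro k hk
        have hk' : X.numObs n 1 ω ≤ k := by simpa using hk
        rw [overlapRatio_comm, overlapRatio_eq_zero_of_le]
        · simp
        · simp only [X.extTime_of_ge hn hk', X.extTime_of_ge hn (hk'.trans (Nat.le_succ k)),
            le_refl]
    · intro m hm
      have hm' : X.numObs n 0 ω ≤ m := by simpa using hm
      have : ∀ k, overlapRatio (X.extTime n 0 · ω) (X.extTime n 1 · ω) m k = 0 := fun k =>
        overlapRatio_eq_zero_of_le (by
          simp only [X.extTime_of_ge hn hm', X.extTime_of_ge hn (hm'.trans (Nat.le_succ m)),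
            le_refl])
      simp [this]

lemma cellTrace_eq_sub (hn : 1 ≤ n) {p : ℕ} (hp : 1 ≤ p) {s : ℕ → ℝ} {k : ℕ} (h0 : 0 ≤ s (k - 1))
    (hk : s (k - 1) ≤ s k) :
    X.cellTrace n p s k ω =
      X.cumulativeTrace p n (s k) ω - X.cumulativeTrace p n (s (k - 1)) ω := by
  rw [cumulativeTrace_sub hn hp h0 hk, pathTrace_extTime_eq_sum hn hp, Finset.sum_range,
    ENNReal.toReal_sum]
  · unfold cellTrace cellMatrix
    rw [Matrix.trace]
    refine Finset.sum_congr rfl fun i _ => ?_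
    rw [Matrix.diag_apply, Matrix.diagonal_mul]
    by_cases hmem : X.time n 0 (i + 1) ω ∈ Set.Ioc (s (k - 1)) (s k)
    · rw [Set.indicator_of_mem hmem, if_pos (Set.mem_Ioc.1 hmem), one_mul,
        ← ofReal_overlapMatrix_gram_pow hn,
        ENNReal.toReal_ofReal (overlapMatrix_gram_pow_nonneg p i i)]
    · rw [Set.indicator_of_notMem hmem, if_neg fun hc => hmem (Set.mem_Ioc.2 hc), zero_mul,
        ENNReal.toReal_zero]
  · intro i _
    by_cases hmem : X.time n 0 (i + 1) ω ∈ Set.Ioc (s (k - 1)) (s k)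
    · rw [Set.indicator_of_mem hmem, ← ofReal_overlapMatrix_gram_pow hn]
      exact ENNReal.ofReal_ne_top
    · rw [Set.indicator_of_notMem hmem]
      exact ENNReal.zero_ne_top

end Traces

end ObservationScheme

/-! ### Convergence of the cell quantities -/

section Combine

variable {Ω : Type*} [m₀ : MeasurableSpace Ω] {P : Measure Ω} [IsProbabilityMeasure P]

lemma maxAbs_le_add {q : ℕ} {x y z : ℕ → ℝ} (h : ∀ k ∈ Finset.Icc 1 q, x k = y k + z k) :
    maxAbs q x ≤ maxAbs q y + maxAbs q z := by
  refine maxAbs_le (add_nonneg (maxAbs_nonneg _ _) (maxAbs_nonneg _ _)) fun k hk => ?_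
  rw [h k hk]
  exact (abs_add_le _ _).trans (add_le_add (le_maxAbs hk) (le_maxAbs hk))

/-- A deterministic perturbation that tends to `0` uniformly does not affect convergence to `0` in
probability of a maximum. -/
lemma tendstoInMeasure_maxAbs_of_eq_add {q : ℕ → ℕ} {x y : ℕ → ℕ → Ω → ℝ} {z : ℕ → ℕ → ℝ}
    (hy : TendstoInMeasure P (fun n ω => maxAbs (q n) (y n · ω)) atTop fun _ => 0)
    (hz : Tendsto (fun n => maxAbs (q n) (z n)) atTop (𝓝 0))
    (h : ∀ᶠ n in atTop, ∀ ω, ∀ k ∈ Finset.Icc 1 (q n), x n k ω = y n k ω + z n k) :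
    TendstoInMeasure P (fun n ω => maxAbs (q n) (x n · ω)) atTop fun _ => 0 := by
  rw [tendstoInMeasure_iff_measureReal_norm] at hy ⊢
  intro ε hε
  refine tendsto_of_tendsto_of_tendsto_of_le_of_le' tendsto_const_nhds (hy (ε / 2) (by positivity))
    (Eventually.of_forall fun n => measureReal_nonneg) ?_
  filter_upwards [h, hz.eventually (gt_mem_nhds (show (0 : ℝ) < ε / 2 by positivity))]
    with n hn hzn
  refine measureReal_mono (fun ω hω => ?_) (measure_ne_top _ _)
  simp only [sub_zero, Set.mem_ofPred_eq, Real.norm_eq_abs, abs_of_nonneg (maxAbs_nonneg _ _)]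
    at hω ⊢
  have := maxAbs_le_add (hn ω)
  linarith

end Combine

namespace ObservationScheme

variable {Ω : Type*} [m₀ : MeasurableSpace Ω] {h : ℕ → ℝ} {X : ObservationScheme Ω h}
  {P : Measure Ω}

/-- The count in the last, incomplete cell has bounded mean on the scale `1 / h_n`. -/
lemma integral_lastCell_le (h_pos : ∀ n, 1 ≤ n → 0 < h n) {C : ℝ}
    (hC : ∀ n, 1 ≤ n → ∀ l, ∀ u < n, Integrable (fun ω => (X.unitCount n l u ω : ℝ) ^ 1) P ∧
      ∫ ω, (X.unitCount n l u ω : ℝ) ^ 1 ∂P ≤ C) (hC0 : 0 ≤ C)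
    {s : ℕ → ℝ} (hs : IsAdmissiblePartition s) {n : ℕ} (hn : 1 ≤ n) (l : Fin 2) :
    Integrable (fun ω => h n * (X.cellCount n l s (lastIndex s (n * h n) + 1) ω : ℝ)) P ∧
      ∫ ω, h n * (X.cellCount n l s (lastIndex s (n * h n) + 1) ω : ℝ) ∂P ≤ (2 + h n) * C := by
  have hh := h_pos n hn
  have hT : (0 : ℝ) ≤ n * h n := by positivity
  set q := lastIndex s (n * h n) with hq
  have hsq : s q ≤ n * h n := hs.apply_lastIndex_le hT
  have hsq1 : n * h n < s (q + 1) := by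
    by_contra hcon
    have := hs.le_lastIndex (not_lt.1 hcon)
    omega
  have hsq0 : 0 ≤ s q := by rw [← hs.zero]; exact hs.strictMono.monotone (Nat.zero_le _)
  have hmono : s q ≤ s (q + 1) := (hs.strictMono (Nat.lt_succ_self q)).le
  set lo := ⌊s q / h n⌋₊ with hlo
  have hlo1 : lo * h n ≤ s q := by
    rw [← le_div_iff₀ hh]; exact Nat.floor_le (by positivity)
  have hlo2 : s q < lo * h n + h n := by
    have := Nat.lt_floor_add_one (s q / h n)
    rw [div_lt_iff₀ hh] at this
    linarith
  have hlon : lo ≤ n := by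
    have : (lo : ℝ) * h n ≤ n * h n := hlo1.trans hsq
    exact_mod_cast le_of_mul_le_mul_right this hh
  have hle : ∀ ω, (X.cellCount n l s (q + 1) ω : ℝ) ≤
      ∑ u ∈ Finset.Ico lo n, (X.unitCount n l u ω : ℝ) := by
    intro ω
    have h1 := X.cellCount_add_counting (n := n) (l := l) (k := q + 1) hmono ω
    have h2 := X.counting_le_numObs n l (s (q + 1)) ω
    rw [← X.counting_of_le hn hT le_rfl] at h2
    have h3 := X.counting_mono n l ω hlo1
    have h4 : ∑ u ∈ Finset.Ico lo n, (X.unitCount n l u ω : ℝ) =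
        (X.counting n l (n * h n) ω : ℝ) - X.counting n l (lo * h n) ω := by
      have := Finset.sum_Ico_sub (fun u : ℕ => (X.counting n l (u * h n) ω : ℝ)) hlon
      rw [← this]
      refine Finset.sum_congr rfl fun u _ => ?_
      rw [cast_unitCount hh.le]
      congr 4
      push_cast; ring
    rw [h4, le_sub_iff_add_le]
    simp only [Nat.add_sub_cancel] at h1
    exact_mod_cast (by omega : X.cellCount n l s (q + 1) ω + X.counting n l (lo * h n) ω ≤
      X.counting n l (n * h n) ω)
  simp only [pow_one] at hC
  have hun : ∀ u ∈ Finset.Ico lo n, u < n := fun u hu => (Finset.mem_Ico.1 hu).2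
  have hsi : Integrable (fun ω => ∑ u ∈ Finset.Ico lo n, (X.unitCount n l u ω : ℝ)) P :=
    integrable_finsetSum _ fun u hu => (hC n hn l u (hun u hu)).1
  have hcm : Measurable fun ω => (X.cellCount n l s (q + 1) ω : ℝ) := by
    have : (fun ω => (X.cellCount n l s (q + 1) ω : ℝ)) = fun ω =>
        (X.counting n l (s (q + 1)) ω : ℝ) - X.counting n l (s q) ω := by
      funext ω
      have h1 := X.cellCount_add_counting (n := n) (l := l) (k := q + 1) hmono ω
      simp only [Nat.add_sub_cancel] at h1
      rw [← h1]; push_cast; ring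
    rw [this]
    exact (measurable_from_top.comp (X.measurable_counting n l _)).sub
      (measurable_from_top.comp (X.measurable_counting n l _))
  have hci : Integrable (fun ω => (X.cellCount n l s (q + 1) ω : ℝ)) P :=
    hsi.mono' hcm.aestronglyMeasurable (ae_of_all _ fun ω => by
      rw [Real.norm_eq_abs, abs_of_nonneg (Nat.cast_nonneg _)]; exact hle ω)
  refine ⟨hci.const_mul _, ?_⟩
  have hsum : ∫ ω, (X.cellCount n l s (q + 1) ω : ℝ) ∂P ≤ ((n - lo : ℕ) : ℝ) * C := by
    refine (integral_mono hci hsi hle).trans ?_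
    rw [integral_finsetSum _ fun u hu => (hC n hn l u (hun u hu)).1]
    refine (Finset.sum_le_card_nsmul _ _ C fun u hu => (hC n hn l u (hun u hu)).2).trans_eq ?_
    rw [Nat.card_Ico, nsmul_eq_mul]
  have hmesh := hs.mesh_le q
  rw [integral_const_mul]
  calc h n * ∫ ω, (X.cellCount n l s (q + 1) ω : ℝ) ∂P ≤ h n * (((n - lo : ℕ) : ℝ) * C) := by gcongr
    _ = (n * h n - lo * h n) * C := by rw [Nat.cast_sub hlon]; ring
    _ ≤ (2 + h n) * C := by gcongr; linarith

variable [IsProbabilityMeasure P]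

/-- Tightness of the last, incomplete cell, by Markov's inequality. -/
lemma isTightMeasureSet_lastCell (h_pos : ∀ n, 1 ≤ n → 0 < h n) (hh0 : Tendsto h atTop (𝓝 0))
    (hB1 : X.CondB1 P (1 : ℕ)) {s : ℕ → ℝ} (hs : IsAdmissiblePartition s) (l : Fin 2) :
    IsTightMeasureSet ((fun n : ℕ => P.map fun ω =>
      h n * (X.cellCount n l s (lastIndex s (n * h n) + 1) ω : ℝ)) '' Set.Ici 1) := by
  obtain ⟨C, hC0, hC⟩ := hB1.exists_integral_le h_pos
  obtain ⟨H, hH⟩ := hh0.bddAbove_range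
  have hH' : ∀ n, h n ≤ H := fun n => hH ⟨n, rfl⟩
  have hH0 : 0 ≤ H := (h_pos 1 le_rfl).le.trans (hH' 1)
  rw [isTightMeasureSet_iff_exists_isCompact_measure_compl_le]
  intro ε hε
  rcases eq_or_ne ε ⊤ with rfl | hεtop
  · exact ⟨∅, isCompact_empty, fun _ _ => le_top⟩
  have hε' : 0 < ε.toReal := ENNReal.toReal_pos hε.ne' hεtop
  -- the level at which Markov's inequality gives `ε`
  set R := ((2 + H) * C + 1) / ε.toReal with hR
  have hR0 : 0 < R := by positivity
  refine ⟨Set.Icc 0 R, isCompact_Icc, ?_⟩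
  rintro _ ⟨n, hn, rfl⟩
  have hn1 : 1 ≤ n := hn
  have hh := h_pos n hn1
  obtain ⟨hi, hle⟩ := integral_lastCell_le h_pos hC hC0 hs hn1 l
  simp only
  rw [Measure.map_apply_of_aemeasurable hi.aemeasurable measurableSet_Icc.compl]
  have hsub : (fun ω => h n * (X.cellCount n l s (lastIndex s (n * h n) + 1) ω : ℝ)) ⁻¹'
      (Set.Icc 0 R)ᶜ ⊆
      {ω | R ≤ h n * (X.cellCount n l s (lastIndex s (n * h n) + 1) ω : ℝ)} := by
    intro ω hω
    simp only [Set.mem_preimage, Set.mem_compl_iff, Set.mem_Icc, not_and_or, not_le] at hω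
    rcases hω with hω | hω
    · exact absurd hω (not_lt.2 (by positivity))
    · exact hω.le
  refine (measure_mono hsub).trans ?_
  rw [← ENNReal.ofReal_toReal hεtop, ← ofReal_measureReal]
  refine ENNReal.ofReal_le_ofReal ?_
  have h1 := (mul_meas_ge_le_integral_of_nonneg (μ := P)
    (ae_of_all _ fun ω => by positivity) hi R).trans hle
  have h2 : (2 + h n) * C ≤ (2 + H) * C + 1 := by
    have := mul_le_mul_of_nonneg_right (add_le_add_right (hH' n) 2) hC0
    linarith
  have h3 : R * ε.toReal = (2 + H) * C + 1 := by rw [hR]; field_simp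
  refine le_of_mul_le_mul_left ?_ hR0
  exact (h1.trans h2).trans_eq h3.symm

/-- Cell quantities that are increments of a local cumulative quantity inherit the limit of their
means. -/
lemma IsLocalCumulative.tendstoInMeasure_of_tendsto_mean {l : Fin 2} {c : ℕ} {A : ℕ → ℝ → Ω → ℝ}
    (hA : X.IsLocalCumulative l c A) (h_pos : ∀ n, 1 ≤ n → 0 < h n)
    (h_decay : ∃ κ : ℝ, 0 < κ ∧ Tendsto (fun n : ℕ => (n : ℝ) * h n ^ κ) atTop (𝓝 0))
    (hB1 : ∀ q : ℝ, 0 < q → X.CondB1 P q) (hB2 : ∀ q : ℝ, 0 < q → X.CondB2 P q)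
    (hmix : ∀ q : ℝ, 0 < q → X.CondMixing P q) {s : ℕ → ℝ} (hs : IsAdmissiblePartition s)
    {V : ℕ → ℕ → Ω → ℝ} (hV : ∀ n k ω, 1 ≤ n → V n k ω = A n (s k) ω - A n (s (k - 1)) ω) {a : ℝ}
    (hmean : Tendsto (fun n : ℕ => maxAbs (lastIndex s (n * h n)) fun k =>
      h n * (∫ ω, V n k ω ∂P) - a * (s k - s (k - 1))) atTop (𝓝 0)) :
    TendstoInMeasure P (fun (n : ℕ) ω => maxAbs (lastIndex s (n * h n)) fun k =>
      h n * V n k ω - a * (s k - s (k - 1))) atTop fun _ => 0 := by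
  refine tendstoInMeasure_maxAbs_of_eq_add
    (x := fun n k ω => h n * V n k ω - a * (s k - s (k - 1)))
    (z := fun n k => h n * (∫ ω, V n k ω ∂P) - a * (s k - s (k - 1)))
    (hA.tendstoInMeasure_maxAbs h_pos h_decay hB1 hB2 hmix hs) hmean ?_
  filter_upwards [eventually_ge_atTop 1] with n hn ω k _
  simp only [hV n k _ hn]
  ring

end ObservationScheme

theorem mainTheorem3 {Ω : Type*} [MeasurableSpace Ω] (P : Measure Ω) [IsProbabilityMeasure P]
    (h : ℕ → ℝ) (h_pos : ∀ n, 1 ≤ n → 0 < h n)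
    (h_horizon : Tendsto (fun n : ℕ => (n : ℝ) * h n) atTop atTop)
    (h_decay : ∃ κ : ℝ, 0 < κ ∧ Tendsto (fun n : ℕ => (n : ℝ) * h n ^ κ) atTop (𝓝 0))
    (X : ObservationScheme Ω h)
    (hB1 : ∀ q : ℝ, 0 < q → X.CondB1 P q)
    (hB2 : ∀ q : ℝ, 0 < q → X.CondB2 P q)
    (hmix : ∀ q : ℝ, 0 < q → X.CondMixing P q)
    (havg : X.CondAverage P) :
    X.AssumptionA4 P := by
  obtain ⟨a₀, a, ha₀, ha, hlim⟩ := havg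
  have hmono : ∀ {s : ℕ → ℝ}, IsAdmissiblePartition s → ∀ k, s (k - 1) ≤ s k := fun hs k =>
    hs.strictMono.monotone (Nat.sub_le k 1)
  refine ⟨⟨a₀, ha₀, fun l s hs => ⟨?_, ?_⟩⟩, fun p hp => ⟨a p, ha p hp, fun s hs => ?_⟩⟩
  · exact ObservationScheme.isTightMeasureSet_lastCell h_pos (exists_scale h_pos h_decay).1
      (hB1 _ (by simp)) hs l
  · refine (X.isLocalCumulative_counting h_pos l).tendstoInMeasure_of_tendsto_mean h_pos h_decay
      hB1 hB2 hmix hs (V := fun n k ω => (X.cellCount n l s k ω : ℝ)) (fun n k ω _ => ?_)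
      ((hlim s hs).1 l)
    rw [← X.cellCount_add_counting (n := n) (l := l) (hmono hs k) ω]
    push_cast; ring
  · refine (X.isLocalCumulative_cumulativeTrace h_pos hp).tendstoInMeasure_of_tendsto_mean h_pos
      h_decay hB1 hB2 hmix hs (V := fun n k ω => X.cellTrace n p s k ω) (fun n k ω hn => ?_)
      ((hlim s hs).2 p hp)
    refine ObservationScheme.cellTrace_eq_sub hn hp ?_ (hmono hs k)
    rw [← hs.zero]
    exact hs.strictMono.monotone (Nat.zero_le _)
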